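/- **Theorem.** For a diagram $D$ of a knot let $\mathbb G_D$ be its all-A ribbon graph (its vertices are the circles of the all-A state of $D$, its edges are the crossings of $D$), and let $q(\mathbb G_D;t)=\sum_j a_jt^j$ be its quasi-tree polynomial, where $a_j$ is the number of quasi-trees of genus $j$, i.e. of spanning ribbon subgraphs of genus $j$ with exactly one boundary component. Let $g_T(D)$ be the genus of the Turaev surface of $D$, so that $2-2g_T(D)=s_A(D)-c(D)+s_B(D)$ with $s_A,s_B$ the numbers of circles of the all-A and the all-B state and $c$ the number of crossings, and let $g_T(K)$ be the minimum of $g_T(D)$ over all diagrams $D$ of the knot $K$. The polynomial $q(\mathbb G_D;t)$ is not an invariant of the knot, even if only diagrams of minimal Turaev genus are considered: there is no function $f$ on the set of knots (up to isotopy) such that $q(\mathbb G_D;t)=f(K)$ for every knot $K$ and every diagram $D$ of $K$ with $g_T(D)=g_T(K)$. This is witnessed by diagrams of the knot $8_{21}$. Write $X[a,b,c,d]$ for a crossing at which the arcs $a,b,c,d$ arrive in counterclockwise order, $a$ and $c$ being parts of the under-strand. Let $D_0$ be the Knot Atlas diagram of $8_{21}$, $$X[1,9,2,8],\ X[15,10,14,9],\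 X[13,2,14,3],\ X[5,16,4,15],\ X[16,5,1,6],\ X[10,4,11,3],\ X[12,7,11,6],\ X[7,12,8,13];$$ let $D_1$ be the result of a Reidemeister III move on its first three crossings, which replaces them by $X[15,2,14,1],\ X[3,9,2,10],\ X[13,8,14,9]$; and let $D_2$ be the KnotScape diagram of $8_{21}$ (Dowker–Thistlethwaite code $4\ 8\ {-12}\ 2\ 14\ {-6}\ 16\ 10$), $$X[4,2,5,1],\ X[8,4,9,3],\ X[5,12,6,13],\ X[2,8,3,7],\ X[14,10,15,9],\ X[11,6,12,7],\ X[16,14,1,13],\ X[10,16,11,15].$$ Let $D_3$ be the mirror image of $D_2$ (all crossings changed). Then $D_0$, $D_1$ and $D_3$ are diagrams of the same knot, so $D_2$ is a diagram of the mirror image of that knot; $g_T(D_0)=2$; the diagrams $D_1,D_2,D_3$ have Turaev genus $1$, which is minimal for the knots that they represent; and $$q(\mathbb G_{D_1};t)=6t+21,\qquad q(\mathbb G_{D_2};t)=24t+9,\qquad q(\mathbb G_{D_3};t)=9t+24 .$$ -/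

import Mathlib

open Polynomial

/-- The number of connected components of the finite multigraph whose edges are the pairs in `L` and
whose vertices are the numbers that occur in these pairs.  (`Quot` passes to the equivalence
relation generated by the given relation.) -/
noncomputable def numClasses (L : List (ℕ × ℕ)) : ℕ :=
  Nat.card (Quot fun x y : {a : ℕ // ∃ p ∈ L, a = p.1 ∨ a = p.2} => (x.1, y.1) ∈ L)

/-! ### Ribbon graphs -/

/-- A band (thickened edge) of a ribbon graph.  One end of the band is glued to the vertex circles
at the place where the arcs `a` and `b` meet, the other end at the place where the arcs `c` and `d`
meet; one side of the band runs from (the end of) `b` to `c`, the other side from `d` to `a`. -/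
structure Band where
  a : ℕ
  b : ℕ
  c : ℕ
  d : ℕ

/-- The corners of a band, in cyclic order, named by the vertex arcs that arrive there. -/
def Band.corners (e : Band) : List ℕ := [e.a, e.b, e.c, e.d]

/-- A finite ribbon graph, given by its attaching data.  The boundary circles of the vertex disks
are cut into arcs, named by natural numbers, by the ends of the bands and possibly by further points
(`joints`), which have no meaning of their own and only allow a circle without any band on it.
Every arc has two ends. -/
structure RibbonGraph where
  joints : List (ℕ × ℕ)
  bands : List Band
  two_ends : ∀ x ∈ joints.flatMap (fun p => [p.1, p.2]) ++ bands.flatMap Band.corners,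
    (joints.flatMap (fun p => [p.1, p.2]) ++ bands.flatMap Band.corners).count x = 2

namespace RibbonGraph

/-- How the arcs of the vertex circles are connected in the boundary of the spanning ribbon subgraph
with edge set `S`: at a band of `S` the boundary follows the two sides of the band, at a band
outside `S` (which is deleted) it continues along the vertex circles. -/
def boundary (G : RibbonGraph) (S : Finset (Fin G.bands.length)) : List (ℕ × ℕ) :=
  G.joints ++ (List.finRange G.bands.length).flatMap fun i =>
    if i ∈ S then [((G.bands.get i).b, (G.bands.get i).c), ((G.bands.get i).d, (G.bands.get i).a)]
    else [((G.bands.get i).a, (G.bands.get i).b), ((G.bands.get i).c, (G.bands.get i).d)]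

/-- The number of boundary components of the spanning ribbon subgraph with edge set `S`. -/
noncomputable def numBoundary (G : RibbonGraph) (S : Finset (Fin G.bands.length)) : ℕ :=
  numClasses (G.boundary S)

/-- The number of vertices; the vertex disks are the spanning ribbon subgraph without edges. -/
noncomputable def numVertices (G : RibbonGraph) : ℕ := G.numBoundary ∅

/-- A quasi-tree: a spanning ribbon subgraph with exactly one boundary component (such a subgraph
is automatically connected). -/
def IsQuasiTree (G : RibbonGraph) (S : Finset (Fin G.bands.length)) : Prop :=
  G.numBoundary S = 1

/-- `S` is a quasi-tree of genus `j`: capping off its boundary component gives a closed surface with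
Euler characteristic `V - E + F = 2 - 2 j`. -/
def IsQuasiTreeOfGenus (G : RibbonGraph) (j : ℕ) (S : Finset (Fin G.bands.length)) : Prop :=
  G.IsQuasiTree S ∧ (G.numVertices : ℤ) - (S.card : ℤ) + 1 = 2 - 2 * (j : ℤ)

/-- The number `a_j` of quasi-trees of genus `j`. -/
noncomputable def numQuasiTrees (G : RibbonGraph) (j : ℕ) : ℕ :=
  Nat.card {S : Finset (Fin G.bands.length) // G.IsQuasiTreeOfGenus j S}

/-- The quasi-tree polynomial `q(G; t) = ∑ a_j t^j`; the genus of a quasi-tree is at most the number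
of edges. -/
noncomputable def quasiTreePolynomial (G : RibbonGraph) : ℤ[X] :=
  ∑ j ∈ Finset.range (G.bands.length + 1), monomial j (G.numQuasiTrees j : ℤ)

end RibbonGraph

/-! ### Knot diagrams on the sphere -/

/-- The vertices of a planar diagram, each given by the names of the arcs that end there:
`point a b` is a marked point on a strand, `crossing a b c d` is a crossing at which the arcs
`a, b, c, d` arrive in this counterclockwise order, `a` and `c` belonging to the under-strand and
`b` and `d` to the over-strand. -/
inductive Tile where
  | point (a b : ℕ) : Tile
  | crossing (a b c d : ℕ) : Tile

namespace Tile

/-- The arcs that end at the vertex, in counterclockwise order. -/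
def ends : Tile → List ℕ
  | point a b => [a, b]
  | crossing a b c d => [a, b, c, d]

/-- Renaming of arcs. -/
def map (f : ℕ → ℕ) : Tile → Tile
  | point a b => point (f a) (f b)
  | crossing a b c d => crossing (f a) (f b) (f c) (f d)

/-- The crossing change. -/
def mirror : Tile → Tile
  | point a b => point a b
  | crossing a b c d => crossing b c d a

/-- The continuation of the strands of the knot through the vertex. -/
def strands : Tile → List (ℕ × ℕ)
  | point a b => [(a, b)]
  | crossing a b c d => [(a, c), (b, d)]

/-- The A-smoothing: it joins the two regions that the over-strand sweeps when it is rotated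
counterclockwise (the one between `b` and `c` and the one between `d` and `a`). -/
def smoothA : Tile → List (ℕ × ℕ)
  | point a b => [(a, b)]
  | crossing a b c d => [(a, b), (c, d)]

/-- The B-smoothing: it joins the two other regions. -/
def smoothB : Tile → List (ℕ × ℕ)
  | point a b => [(a, b)]
  | crossing a b c d => [(b, c), (d, a)]

def joint? : Tile → List (ℕ × ℕ)
  | point a b => [(a, b)]
  | crossing _ _ _ _ => []

/-- The band that replaces a crossing in the all-A ribbon graph: both its ends lie on the circles of
the all-A state, and its sides are the arcs of the B-smoothing. -/
def band? : Tile → List Band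
  | point _ _ => []
  | crossing a b c d => [⟨a, b, c, d⟩]

end Tile

/-- A planar diagram code: the list of the vertices of the diagram. -/
abbrev Code : Type := List Tile

namespace Code

/-- The arcs, each listed once for every end. -/
def arcEnds (D : Code) : List ℕ := D.flatMap Tile.ends

/-- The number of crossings. -/
def numCrossings (D : Code) : ℕ := (D.flatMap Tile.band?).length

/-- The ends of arcs at the vertices: the `j`-th end at the `i`-th vertex. The same type indexes the
corners: `⟨i, j⟩` also stands for the corner at the `i`-th vertex between its ends `j` and `j + 1`
(counted cyclically). -/
abbrev Slot (D : Code) : Type := Σ i : Fin D.length, Fin ((D.get i).ends.length)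

/-- The arc that ends at a slot. -/
def Slot.arc {D : Code} (s : D.Slot) : ℕ := (D.get s.1).ends.get s.2

/-- The next slot at the same vertex, counterclockwise. -/
def Slot.succ {D : Code} (s : D.Slot) : D.Slot :=
  ⟨s.1, ⟨(s.2.1 + 1) % (D.get s.1).ends.length, Nat.mod_lt _ (Nat.zero_lt_of_lt s.2.2)⟩⟩

/-- The number of faces of the surface embedding that is given by the cyclic orders at the vertices.
Going along the boundary of a face, the corner `s`, which is bounded by the end `s.succ`, is followed
by the corner `t` that starts at the other end `t` of the same arc. -/
noncomputable def numFaces (D : Code) : ℕ :=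
  Nat.card (Quot fun s t : D.Slot => s.succ ≠ t ∧ s.succ.arc = t.arc)

end Code

/-- A (nonempty) knot diagram on the oriented sphere, up to orientation-preserving homeomorphism:
every arc has two ends, there is a single closed strand, and the embedding given by the
counterclockwise orders has Euler characteristic `2`.  For `n` crossings and `m` marked points there
are `n + m` vertices and `2 n + m` arcs, so the latter means `n + 2` faces.  The diagram without
crossings is `[point a a]`. -/
structure KnotDiagram where
  code : Code
  two_ends : ∀ x ∈ code.arcEnds, code.arcEnds.count x = 2
  one_component : numClasses (code.flatMap Tile.strands) = 1
  planar : code.numFaces = code.numCrossings + 2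

open Tile in
/-- Different codes of the same diagram: vertices may be listed in another order, the ends at a
vertex may be listed from another starting point, arcs may be renamed, and a marked point between
two different arcs `a` and `b` may be erased, whereby `a` and `b` become one arc. -/
inductive SameDiagram : Code → Code → Prop
  | perm {D D' : Code} : D.Perm D' → SameDiagram D D'
  | rotateCrossing (a b c d : ℕ) (L : Code) :
      SameDiagram (crossing a b c d :: L) (crossing c d a b :: L)
  | rotatePoint (a b : ℕ) (L : Code) : SameDiagram (point a b :: L) (point b a :: L)
  | rename (f : Equiv.Perm ℕ) (D : Code) : SameDiagram D (D.map (Tile.map f))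
  | erase (a b : ℕ) (L : Code) : a ≠ b →
      SameDiagram (point a b :: L) (L.map (Tile.map fun x => if x = b then a else x))

open Tile in
/-- The first Reidemeister move: removal of a kink, of either type. -/
inductive ReidemeisterI : Code → Code → Prop
  | kink (a b c : ℕ) (L : Code) : ReidemeisterI (crossing a a b c :: L) (point b c :: L)
  | kink' (a b c : ℕ) (L : Code) : ReidemeisterI (crossing a b b c :: L) (point a c :: L)

open Tile in
/-- The second Reidemeister move: removal of a bigon with sides `u` and `o`, where `u` lies on the
strand that is below at both crossings and `o` on the strand that is above at both crossings. -/
inductive ReidemeisterII : Code → Code → Prop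
  | bigon (u o x y x' y' : ℕ) (L : Code) :
      ReidemeisterII (crossing u o x y :: crossing x' o u y' :: L) (point x x' :: point y y' :: L)

open Tile in
/-- The third Reidemeister move.  The ends on the boundary of a disk are `p₁, …, p₆` in
counterclockwise order, the strands are `p₁ – i₁ – p₄`, `p₂ – i₂ – p₅` and `p₃ – i₃ – p₆`, and the
triangle has sides `i₁, i₂, i₃`; before the move its corners face `p₁p₂`, `p₃p₄`, `p₅p₆`, afterwards
they face `p₂p₃`, `p₄p₅`, `p₆p₁`.  In the first case the strands are listed from top to bottom, in
the second case from bottom to top. -/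
inductive ReidemeisterIII : Code → Code → Prop
  | down (p₁ p₂ p₃ p₄ p₅ p₆ i₁ i₂ i₃ : ℕ) (L : Code) :
      ReidemeisterIII
        (crossing p₂ i₁ i₂ p₁ :: crossing p₃ p₄ i₃ i₁ :: crossing p₆ i₂ i₃ p₅ :: L)
        (crossing p₃ i₂ i₃ p₂ :: crossing p₅ i₁ i₂ p₄ :: crossing p₆ p₁ i₃ i₁ :: L)
  | up (p₁ p₂ p₃ p₄ p₅ p₆ i₁ i₂ i₃ : ℕ) (L : Code) :
      ReidemeisterIII
        (crossing p₁ p₂ i₁ i₂ :: crossing p₄ i₃ i₁ p₃ :: crossing p₅ p₆ i₂ i₃ :: L)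
        (crossing p₂ p₃ i₂ i₃ :: crossing p₄ p₅ i₁ i₂ :: crossing p₁ i₃ i₁ p₆ :: L)

/-- One Reidemeister move, or a change of the code of a diagram. -/
def ReidemeisterStep (D D' : KnotDiagram) : Prop :=
  SameDiagram D.code D'.code ∨ ReidemeisterI D.code D'.code ∨ ReidemeisterII D.code D'.code ∨
    ReidemeisterIII D.code D'.code

/-- A (classical, unoriented) knot: a knot diagram up to Reidemeister moves. -/
def Knot : Type := Quot ReidemeisterStep

namespace KnotDiagram

/-- The knot that is represented by a diagram. -/
def knot (D : KnotDiagram) : Knot := Quot.mk ReidemeisterStep D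

/-- The number of circles of the all-A state. -/
noncomputable def numCirclesA (D : KnotDiagram) : ℕ := numClasses (D.code.flatMap Tile.smoothA)

/-- The number of circles of the all-B state. -/
noncomputable def numCirclesB (D : KnotDiagram) : ℕ := numClasses (D.code.flatMap Tile.smoothB)

/-- The Turaev surface of `D` is the cobordism between the all-A and the all-B state of `D` that has
one saddle for each crossing, with all boundary circles capped off by disks.  It is a closed
connected oriented surface with Euler characteristic `s_A - c + s_B`, and the Turaev genus of `D` is
its genus. -/
def HasTuraevGenus (D : KnotDiagram) (g : ℕ) : Prop :=
  (D.numCirclesA : ℤ) - (D.code.numCrossings : ℤ) + (D.numCirclesB : ℤ) = 2 - 2 * (g : ℤ)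

/-- The all-A ribbon graph of a diagram: the vertices are the circles of the all-A state, the edges
are the crossings. -/
def allA (D : KnotDiagram) : RibbonGraph where
  joints := D.code.flatMap Tile.joint?
  bands := D.code.flatMap Tile.band?
  two_ends := by
    have key : ∀ L : Code,
        (((L.flatMap Tile.joint?).flatMap fun p => [p.1, p.2]) ++
          (L.flatMap Tile.band?).flatMap Band.corners).Perm L.arcEnds := by
      intro L
      induction L with
      | nil => exact List.Perm.refl _
      | cons T L ih =>
        cases T with
        | point a b =>
          simpa [Code.arcEnds, Tile.joint?, Tile.band?, Tile.ends] using ih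
        | crossing a b c d =>
          refine List.Perm.trans ?_ (List.Perm.append_left [a, b, c, d] ih)
          simp only [List.flatMap_cons, Tile.joint?, Tile.band?, List.nil_append,
            List.cons_append, Band.corners]
          refine List.Perm.trans (List.perm_append_comm (l₂ := a :: b :: c :: d :: _)) ?_
          simp only [List.cons_append]
          refine .cons _ (.cons _ (.cons _ (.cons _ ?_)))
          simpa [Band.corners] using List.perm_append_comm
    intro x hx
    rw [(key D.code).count_eq]
    exact D.two_ends x ((key D.code).mem_iff.1 hx)

end KnotDiagram

/-- The Turaev genus of a knot: the minimum of the Turaev genera of its diagrams. -/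
noncomputable def Knot.turaevGenus (K : Knot) : ℕ :=
  sInf {g : ℕ | ∃ D : KnotDiagram, D.knot = K ∧ D.HasTuraevGenus g}

/-- The diagram has minimal Turaev genus among the diagrams of the same knot. -/
def KnotDiagram.HasMinimalTuraevGenus (D : KnotDiagram) : Prop :=
  D.HasTuraevGenus D.knot.turaevGenus

/-! ### Diagrams of the knot `8_21` -/

namespace EightTwentyOne

open Tile

/-- The diagram of the Knot Atlas. -/
def knotAtlas : Code :=
  [crossing 1 9 2 8, crossing 15 10 14 9, crossing 13 2 14 3, crossing 5 16 4 15,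
   crossing 16 5 1 6, crossing 10 4 11 3, crossing 12 7 11 6, crossing 7 12 8 13]

/-- The result of a Reidemeister III move on the first three crossings of `knotAtlas`. -/
def knotAtlasMoved : Code :=
  [crossing 15 2 14 1, crossing 3 9 2 10, crossing 13 8 14 9, crossing 5 16 4 15,
   crossing 16 5 1 6, crossing 10 4 11 3, crossing 12 7 11 6, crossing 7 12 8 13]

/-- The diagram of KnotScape, with Dowker–Thistlethwaite code `4 8 -12 2 14 -6 16 10`. -/
def knotScape : Code :=
  [crossing 4 2 5 1, crossing 8 4 9 3, crossing 5 12 6 13, crossing 2 8 3 7,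
   crossing 14 10 15 9, crossing 11 6 12 7, crossing 16 14 1 13, crossing 10 16 11 15]

/-- The mirror image of the diagram of KnotScape. -/
def knotScapeMirror : Code := knotScape.map Tile.mirror

end EightTwentyOne

/-!
The four diagrams and their quasi-tree polynomials are finite data: numbers of components, of faces
and of quasi-trees are evaluated by `countClasses`, which contracts the edges of a graph one by one
(`numClasses_eq_countClasses`).  The mirrored KnotScape diagram is reached from the Knot Atlas diagram
by Reidemeister moves, namely by the addition of a kink, by moves of type III, and by the removal of
a kink (`EightTwentyOne.movesToKnotScapeMirror`).  Hence two diagrams of one knot, both of Turaev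
genus `1`, have different polynomials, and it remains to see that this genus is minimal, that is, that
neither `8_21` nor its mirror image has a diagram of Turaev genus `0`.

The obstruction is an extreme coefficient of the Kauffman bracket.  Up to units `±A ^ k` the bracket
is an invariant of the knot (`bracket_reidemeisterI`, `bracket_reidemeisterII`,
`bracket_reidemeisterIII`).  For a diagram of Turaev genus `0` both extreme coefficients are `±1`
(`Code.unitLead_of_genus_zero`).  Indeed, `s_A + s_B ≤ c + 2 k` for all diagrams with `k` components
of the projection (`Code.circlesA_add_circlesB_le`).  In the case of equality, a crossing that joins a
circle of the all-A state to itself must be nugatory, since the inequality fails for its B-smoothing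
otherwise, and its A-smoothing changes the bracket by a unit (`bracket_smoothB_of_split`).  When no
such crossing is left, the all-A state is adequate and alone contributes to the highest power of `A`
(`Code.exists_bracket_eq_of_adequate`).  The mirror image yields the lowest power.  But the lowest
coefficient of the bracket of `8_21` is `-2` (`EightTwentyOne.not_unitLead_knotScapeMirror`).

Instead of Laurent polynomials, the values at `A = 5` and `A = 1 / 5` are used: the extreme
coefficients modulo `5` are then the leading `5`-adic digits (`UnitLead`).
-/

/-! ### Counting the components of a list of pairs -/

/-- The vertex `x` occurs in one of the pairs of `L`. -/
abbrev Occurs (L : List (ℕ × ℕ)) (x : ℕ) : Prop := ∃ p ∈ L, x = p.1 ∨ x = p.2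

/-- The vertices `x` and `y` are equal or connected by the pairs of `L`. -/
def Conn (L : List (ℕ × ℕ)) : ℕ → ℕ → Prop := Relation.EqvGen fun x y => (x, y) ∈ L

namespace Conn

variable {L L' : List (ℕ × ℕ)} {x y z : ℕ}

theorem refl (x : ℕ) : Conn L x x := Relation.EqvGen.refl x

theorem symm (h : Conn L x y) : Conn L y x := Relation.EqvGen.symm _ _ h

theorem trans (h : Conn L x y) (h' : Conn L y z) : Conn L x z := Relation.EqvGen.trans _ _ _ h h'

theorem of_mem (h : (x, y) ∈ L) : Conn L x y := Relation.EqvGen.rel _ _ h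

theorem mono (h : ∀ p ∈ L, Conn L' p.1 p.2) (hxy : Conn L x y) : Conn L' x y := by
  induction hxy with
  | rel x y h' => exact h _ h'
  | refl x => exact refl x
  | symm x y _ ih => exact ih.symm
  | trans x y z _ _ ih ih' => exact ih.trans ih'

theorem of_subset (h : L ⊆ L') (hxy : Conn L x y) : Conn L' x y :=
  hxy.mono fun _ hp => of_mem (h hp)

end Conn

theorem quot_mk_eq_iff_conn {L : List (ℕ × ℕ)} (x y : {a : ℕ // Occurs L a}) :
    Quot.mk (fun x y : {a : ℕ // Occurs L a} => (x.1, y.1) ∈ L) x = Quot.mk _ y ↔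
      Conn L x.1 y.1 := by
  constructor
  · intro h
    have h' := Quot.eqvGen_exact h
    induction h' with
    | rel x y h' => exact .of_mem h'
    | refl x => exact .refl _
    | symm x y _ ih => exact (ih (Quot.eqvGen_sound ‹_›)).symm
    | trans x y z _ _ ih ih' =>
      exact (ih (Quot.eqvGen_sound ‹_›)).trans (ih' (Quot.eqvGen_sound ‹_›))
  · obtain ⟨x, hx⟩ := x
    obtain ⟨y, hy⟩ := y
    intro h
    have key : ∀ x y, Conn L x y → x = y ∨ ∃ (hx : Occurs L x) (hy : Occurs L y),
        Quot.mk (fun x y : {a : ℕ // Occurs L a} => (x.1, y.1) ∈ L) ⟨x, hx⟩ =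
          Quot.mk _ ⟨y, hy⟩ := by
      intro x y h
      induction h with
      | rel x y h' => exact Or.inr ⟨⟨_, h', Or.inl rfl⟩, ⟨_, h', Or.inr rfl⟩, Quot.sound h'⟩
      | refl x => exact Or.inl rfl
      | symm x y _ ih =>
        rcases ih with rfl | ⟨hx, hy, h⟩
        · exact Or.inl rfl
        · exact Or.inr ⟨hy, hx, h.symm⟩
      | trans x y z _ _ ih ih' =>
        rcases ih with rfl | ⟨hx, hy, h⟩
        · exact ih'
        · rcases ih' with rfl | ⟨hy', hz, h'⟩
          · exact Or.inr ⟨hx, hy, h⟩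
          · exact Or.inr ⟨hx, hz, h.trans h'⟩
    rcases key x y h with h | ⟨_, _, h⟩
    · subst h
      rfl
    · exact h

instance finite_occurs (L : List (ℕ × ℕ)) : Finite {a : ℕ // Occurs L a} := by
  refine Set.Finite.to_subtype (s := {a | Occurs L a})
    ((L.flatMap fun p => [p.1, p.2]).finite_toSet.subset ?_)
  rintro x ⟨p, hp, h⟩
  simp only [Set.mem_ofPred_eq, List.mem_flatMap]
  exact ⟨p, hp, by simpa using h⟩

section numClasses

variable {L L' : List (ℕ × ℕ)} {a b : ℕ}

theorem numClasses_congr (ho : ∀ x, Occurs L x ↔ Occurs L' x)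
    (h : ∀ p ∈ L, Conn L' p.1 p.2) (h' : ∀ p ∈ L', Conn L p.1 p.2) :
    numClasses L = numClasses L' := by
  refine Nat.card_congr
    ⟨Quot.lift (fun x => Quot.mk _ ⟨x.1, (ho _).1 x.2⟩) ?_,
      Quot.lift (fun x => Quot.mk _ ⟨x.1, (ho _).2 x.2⟩) ?_, ?_, ?_⟩
  · intro x y hxy
    exact (quot_mk_eq_iff_conn _ _).2 (h _ hxy)
  · intro x y hxy
    exact (quot_mk_eq_iff_conn _ _).2 (h' _ hxy)
  · rintro ⟨x⟩
    rfl
  · rintro ⟨x⟩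
    rfl

/-- Only the set of the unordered pairs matters. -/
theorem numClasses_congr_swap (h : ∀ p ∈ L, p ∈ L' ∨ p.swap ∈ L')
    (h' : ∀ p ∈ L', p ∈ L ∨ p.swap ∈ L) : numClasses L = numClasses L' := by
  have occ : ∀ L L' : List (ℕ × ℕ), (∀ p ∈ L, p ∈ L' ∨ p.swap ∈ L') →
      ∀ x, Occurs L x → Occurs L' x := by
    rintro L L' h x ⟨p, hp, hx⟩
    rcases h p hp with hp' | hp'
    · exact ⟨p, hp', hx⟩
    · exact ⟨_, hp', hx.symm⟩
  have con : ∀ L L' : List (ℕ × ℕ), (∀ p ∈ L, p ∈ L' ∨ p.swap ∈ L') →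
      ∀ p ∈ L, Conn L' p.1 p.2 := by
    rintro L L' h p hp
    rcases h p hp with hp' | hp'
    · exact .of_mem hp'
    · exact (Conn.of_mem hp').symm
  exact numClasses_congr (fun x => ⟨occ _ _ h x, occ _ _ h' x⟩) (con _ _ h) (con _ _ h')

theorem numClasses_perm (h : L.Perm L') : numClasses L = numClasses L' :=
  numClasses_congr_swap (fun _ hp => Or.inl (h.mem_iff.1 hp)) fun _ hp => Or.inl (h.mem_iff.2 hp)

theorem numClasses_swap : numClasses ((a, b) :: L) = numClasses ((b, a) :: L) := by
  apply numClasses_congr_swap <;> simp +contextual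

theorem occurs_cons {p : ℕ × ℕ} {x : ℕ} :
    Occurs (p :: L) x ↔ (x = p.1 ∨ x = p.2) ∨ Occurs L x := by
  simp [Occurs]

theorem occurs_append {x : ℕ} : Occurs (L ++ L') x ↔ Occurs L x ∨ Occurs L' x := by
  simp only [Occurs, List.mem_append, or_and_right, exists_or]

theorem occurs_iff {x : ℕ} : Occurs L x ↔ x ∈ L.flatMap fun p => [p.1, p.2] := by
  simp [Occurs]

theorem numClasses_cons_of_conn (ha : Occurs L a) (hb : Occurs L b) (h : Conn L a b) :
    numClasses ((a, b) :: L) = numClasses L := by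
  refine numClasses_congr (fun x => ?_) ?_ ?_
  · rw [occurs_cons]
    constructor
    · rintro ((rfl | rfl) | h) <;> assumption
    · exact Or.inr
  · rintro p hp
    rcases List.mem_cons.1 hp with rfl | hp
    · exact h
    · exact .of_mem hp
  · intro p hp
    exact .of_mem (List.mem_cons_of_mem _ hp)

theorem numClasses_cons_of_not_conn (ha : Occurs L a) (hb : Occurs L b) (h : ¬ Conn L a b) :
    numClasses L = numClasses ((a, b) :: L) + 1 := by
  classical
  let r := fun x y : {a : ℕ // Occurs L a} => (x.1, y.1) ∈ L
  have hab : (Quot.mk r ⟨a, ha⟩) ≠ Quot.mk r ⟨b, hb⟩ := fun e => h ((quot_mk_eq_iff_conn _ _).1 e)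
  have ho : ∀ x, Occurs ((a, b) :: L) x ↔ Occurs L x := by
    intro x
    rw [occurs_cons]
    constructor
    · rintro ((rfl | rfl) | h) <;> assumption
    · exact Or.inr
  -- The classes after the merging correspond to the old classes except that of `b`.
  have e : Quot (fun x y : {x : ℕ // Occurs ((a, b) :: L) x} => (x.1, y.1) ∈ (a, b) :: L) ≃
      {q : Quot r // q ≠ Quot.mk r ⟨b, hb⟩} := by
    refine ⟨Quot.lift (fun x => if h : Quot.mk r ⟨x.1, (ho _).1 x.2⟩ = Quot.mk r ⟨b, hb⟩
        then ⟨Quot.mk r ⟨a, ha⟩, hab⟩ else ⟨Quot.mk r ⟨x.1, (ho _).1 x.2⟩, h⟩) ?_,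
      fun q => Quot.lift (fun x => Quot.mk _ ⟨x.1, (ho _).2 x.2⟩) ?_ q.1, ?_, ?_⟩
    · rintro ⟨x, hx⟩ ⟨y, hy⟩ (hxy : (x, y) ∈ (a, b) :: L)
      rcases List.mem_cons.1 hxy with hxy | hxy
      · obtain ⟨rfl, rfl⟩ := Prod.mk.inj hxy
        simp [hab]
      · have : Quot.mk r ⟨x, (ho _).1 hx⟩ = Quot.mk r ⟨y, (ho _).1 hy⟩ := Quot.sound hxy
        simp only [this]
    · intro x y hxy
      exact Quot.sound (List.mem_cons_of_mem _ hxy)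
    · rintro ⟨⟨x, hx⟩⟩
      dsimp only
      split_ifs with hxb
      · refine (quot_mk_eq_iff_conn _ _).2 ?_
        exact (Conn.of_mem (List.mem_cons_self ..)).trans
          (((quot_mk_eq_iff_conn _ _).1 hxb).symm.of_subset (List.subset_cons_self ..))
      · rfl
    · rintro ⟨⟨x⟩, hx⟩
      exact dif_neg hx
  have : Finite (Quot r) := inferInstance
  rw [show numClasses ((a, b) :: L) = _ from Nat.card_congr e, ← Finite.card_option]
  exact Nat.card_congr (Equiv.optionSubtypeNe (Quot.mk r ⟨b, hb⟩)).symm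

/-- The identification of `b` with `a`. -/
def merge (a b : ℕ) (x : ℕ) : ℕ := if x = b then a else x

/-- A pair can be contracted, unless its component has no other pairs. -/
theorem numClasses_cons_of_occurs (h : Occurs L a ∨ Occurs L b) :
    numClasses ((a, b) :: L) = numClasses (L.map (Prod.map (merge a b) (merge a b))) := by
  have h1 : ∀ x, Occurs ((a, b) :: L) x →
      Occurs (L.map (Prod.map (merge a b) (merge a b))) (merge a b x) := by
    have key : ∀ x, Occurs L x →
        Occurs (L.map (Prod.map (merge a b) (merge a b))) (merge a b x) := by
      rintro x ⟨p, hp, hx⟩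
      refine ⟨_, List.mem_map_of_mem hp, ?_⟩
      rcases hx with rfl | rfl
      · exact Or.inl rfl
      · exact Or.inr rfl
    have ha : merge a b a = a := by simp [merge]
    have hb : merge a b b = a := by simp [merge]
    have hab : Occurs (L.map (Prod.map (merge a b) (merge a b))) a := by
      rcases h with h | h
      · simpa only [ha] using key a h
      · simpa only [hb] using key b h
    intro x hx
    rcases occurs_cons.1 hx with (rfl | rfl) | hx
    · simpa only [ha] using hab
    · simpa only [hb] using hab
    · exact key x hx
  have h2 : ∀ x, Conn ((a, b) :: L) x (merge a b x) := by
    intro x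
    unfold merge
    split_ifs with hx
    · subst hx
      exact (Conn.of_mem (List.mem_cons_self ..)).symm
    · exact .refl x
  have h3 : ∀ x, Occurs (L.map (Prod.map (merge a b) (merge a b))) x → Occurs ((a, b) :: L) x := by
    have key : ∀ x, Occurs ((a, b) :: L) x → Occurs ((a, b) :: L) (merge a b x) := by
      intro x hx
      unfold merge
      split_ifs
      · exact ⟨_, List.mem_cons_self .., Or.inl rfl⟩
      · exact hx
    rintro x ⟨p, hp, hx⟩
    obtain ⟨p, hp', rfl⟩ := List.mem_map.1 hp
    rcases hx with rfl | rfl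
    · exact key _ ⟨p, List.mem_cons_of_mem _ hp', Or.inl rfl⟩
    · exact key _ ⟨p, List.mem_cons_of_mem _ hp', Or.inr rfl⟩
  refine Nat.card_congr ⟨Quot.lift (fun x => Quot.mk _ ⟨merge a b x.1, h1 _ x.2⟩) ?_,
    Quot.lift (fun x => Quot.mk _ ⟨x.1, h3 _ x.2⟩) ?_, ?_, ?_⟩
  · rintro ⟨x, hx⟩ ⟨y, hy⟩ (hxy : (x, y) ∈ (a, b) :: L)
    rcases List.mem_cons.1 hxy with hxy | hxy
    · obtain ⟨rfl, rfl⟩ := Prod.mk.inj hxy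
      simp [merge]
    · exact Quot.sound (List.mem_map.2 ⟨_, hxy, rfl⟩)
  · rintro ⟨x, hx⟩ ⟨y, hy⟩ hxy
    obtain ⟨⟨u, v⟩, hp, he⟩ := List.mem_map.1 hxy
    obtain ⟨rfl, rfl⟩ := Prod.mk.inj he
    refine (quot_mk_eq_iff_conn _ _).2 ?_
    exact (h2 u).symm.trans ((Conn.of_mem (List.mem_cons_of_mem _ hp)).trans (h2 v))
  · rintro ⟨⟨x, hx⟩⟩
    exact (quot_mk_eq_iff_conn _ _).2 (h2 x).symm
  · rintro ⟨⟨x, hx⟩⟩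
    have : merge a b x = x := by
      obtain ⟨p, hp, hx⟩ := hx
      obtain ⟨⟨u, v⟩, hp', rfl⟩ := List.mem_map.1 hp
      have key : ∀ u, merge a b (merge a b u) = merge a b u := by
        intro u
        unfold merge
        split_ifs <;> simp_all
      rcases hx with rfl | rfl <;> exact key _
    simp only [this]

theorem numClasses_cons_of_not_occurs (ha : ¬ Occurs L a) (hb : ¬ Occurs L b) :
    numClasses ((a, b) :: L) = numClasses L + 1 := by
  classical
  let r := fun x y : {a : ℕ // Occurs L a} => (x.1, y.1) ∈ L
  have : Finite (Quot r) := inferInstance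
  have h1 : ∀ x, Occurs ((a, b) :: L) x → ¬ Occurs L x → x = a ∨ x = b := by
    intro x hx hx'
    exact (occurs_cons.1 hx).resolve_right hx'
  refine Eq.trans (Nat.card_congr (β := Option (Quot r)) ⟨Quot.lift (fun x =>
      if hx : Occurs L x.1 then some (Quot.mk r ⟨x.1, hx⟩) else none) ?_,
    fun q => q.elim (Quot.mk _ ⟨a, _, List.mem_cons_self .., Or.inl rfl⟩) (Quot.lift (fun x =>
      Quot.mk _ ⟨x.1, occurs_cons.2 (Or.inr x.2)⟩) ?_), ?_, ?_⟩) Finite.card_option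
  · rintro ⟨x, hx⟩ ⟨y, hy⟩ (hxy : (x, y) ∈ (a, b) :: L)
    rcases List.mem_cons.1 hxy with hxy | hxy
    · obtain ⟨rfl, rfl⟩ := Prod.mk.inj hxy
      simp [ha, hb]
    · have hx' : Occurs L x := ⟨_, hxy, Or.inl rfl⟩
      have hy' : Occurs L y := ⟨_, hxy, Or.inr rfl⟩
      simp only [hx', hy', dif_pos]
      exact congrArg some (Quot.sound hxy)
  · intro x y hxy
    exact Quot.sound (List.mem_cons_of_mem _ hxy)
  · rintro ⟨⟨x, hx⟩⟩
    dsimp only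
    split_ifs with hx'
    · rfl
    · refine (quot_mk_eq_iff_conn _ _).2 ?_
      rcases h1 x hx hx' with rfl | rfl
      · exact .refl _
      · exact .of_mem (List.mem_cons_self ..)
  · rintro (_ | ⟨⟨x, hx⟩⟩)
    · exact dif_neg ha
    · exact dif_pos hx

theorem numClasses_nil : numClasses [] = 0 := by
  have : IsEmpty {a : ℕ // Occurs [] a} := ⟨fun x => by simpa [Occurs] using x.2⟩
  have : IsEmpty (Quot fun x y : {a : ℕ // Occurs [] a} => (x.1, y.1) ∈ ([] : List (ℕ × ℕ))) :=
    ⟨by rintro ⟨x⟩; exact this.elim x⟩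
  exact Nat.card_of_isEmpty

theorem numClasses_map_perm (f : Equiv.Perm ℕ) (L : List (ℕ × ℕ)) :
    numClasses (L.map (Prod.map f f)) = numClasses L := by
  refine (Nat.card_congr (Quot.congr (f.subtypeEquiv fun x => ?_) fun x y => ?_)).symm
  · simp
  · simp [Equiv.subtypeEquiv_apply]

end numClasses

/-- An algorithm for `numClasses`: it contracts one pair after the other. The first argument bounds
the number of steps. -/
def countClasses : ℕ → List (ℕ × ℕ) → ℕ
  | 0, _ => 0
  | _ + 1, [] => 0
  | n + 1, p :: L =>
    if L.any fun q => q.1 == p.1 || q.2 == p.1 || q.1 == p.2 || q.2 == p.2 then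
      countClasses n (L.map (Prod.map (merge p.1 p.2) (merge p.1 p.2)))
    else countClasses n L + 1

theorem numClasses_eq_countClasses (L : List (ℕ × ℕ)) :
    numClasses L = countClasses L.length L := by
  have key : ∀ n (L : List (ℕ × ℕ)), L.length = n → numClasses L = countClasses n L := by
    intro n
    induction n with
    | zero =>
      intro L hL
      obtain rfl := List.length_eq_zero_iff.1 hL
      exact numClasses_nil
    | succ n ih =>
      rintro (_ | ⟨⟨a, b⟩, L⟩) hL
      · simp at hL
      have hL : L.length = n := by simpa using hL
      unfold countClasses
      split_ifs with h
      · rw [← ih _ (by simpa using hL)]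
        apply numClasses_cons_of_occurs
        obtain ⟨q, hq, h⟩ := List.any_eq_true.1 h
        simp only [Bool.or_eq_true, beq_iff_eq] at h
        rcases h with ((h | h) | h) | h
        · exact Or.inl ⟨q, hq, Or.inl h.symm⟩
        · exact Or.inl ⟨q, hq, Or.inr h.symm⟩
        · exact Or.inr ⟨q, hq, Or.inl h.symm⟩
        · exact Or.inr ⟨q, hq, Or.inr h.symm⟩
      · rw [← ih _ hL]
        apply numClasses_cons_of_not_occurs
        · rintro ⟨q, hq, h'⟩
          refine h (List.any_eq_true.2 ⟨q, hq, ?_⟩)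
          rcases h' with h' | h' <;> simp [h'.symm]
        · rintro ⟨q, hq, h'⟩
          refine h (List.any_eq_true.2 ⟨q, hq, ?_⟩)
          rcases h' with h' | h' <;> simp [h'.symm]
  exact key _ L rfl

/-! ### The Kauffman bracket -/

/-- The value at `A` of the Kauffman bracket `∑ A ^ (a(s) - b(s)) * (-A ^ 2 - A ^ (-2)) ^ |s|` of the
diagram with code `D`, where `s` runs through the states, `a(s)` and `b(s)` are the numbers of A- and
B-smoothings and `|s|` is the number of circles, so that the bracket of a circle is
`-A ^ 2 - A ^ (-2)`.  The pairs of the second argument are added to all states. -/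
noncomputable def bracket (A : ℚ) : Code → List (ℕ × ℕ) → ℚ
  | [], P => (-A ^ 2 - A⁻¹ ^ 2) ^ numClasses P
  | .point a b :: D, P => bracket A D ((a, b) :: P)
  | .crossing a b c d :: D, P =>
    A * bracket A D ((a, b) :: (c, d) :: P) + A⁻¹ * bracket A D ((b, c) :: (d, a) :: P)

section bracket

variable {A : ℚ} {D : Code} {P Q : List (ℕ × ℕ)}

/-- The arcs of `D` that the states of `D` connect are arcs of `D`, so that only arcs of `D` matter
for the comparison of the numbers of circles. -/
theorem bracket_congr {k : ℕ} (h : ∀ M : List (ℕ × ℕ), (∀ x, Occurs M x → x ∈ D.arcEnds) →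
    numClasses (M ++ P) = numClasses (M ++ Q) + k) :
    bracket A D P = (-A ^ 2 - A⁻¹ ^ 2) ^ k * bracket A D Q := by
  induction D generalizing P Q with
  | nil =>
    have := h [] (by simp [Occurs])
    simp only [List.nil_append] at this
    simp only [bracket, this, pow_add]
    ring
  | cons T D ih =>
    have key : ∀ S : List (ℕ × ℕ), (∀ x, Occurs S x → x ∈ T.ends) →
        bracket A D (S ++ P) = (-A ^ 2 - A⁻¹ ^ 2) ^ k * bracket A D (S ++ Q) := by
      intro S hS
      refine ih fun M hM => ?_
      rw [← List.append_assoc, ← List.append_assoc]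
      refine h _ fun x hx => ?_
      rw [Code.arcEnds, List.flatMap_cons, List.mem_append]
      rcases occurs_append.1 hx with hx | hx
      · exact Or.inr (hM x hx)
      · exact Or.inl (hS x hx)
    cases T with
    | point a b => exact key [(a, b)] (by simp [Occurs, Tile.ends])
    | crossing a b c d =>
      have h1 := key [(a, b), (c, d)] (by simp [Occurs, Tile.ends]; tauto)
      have h2 := key [(b, c), (d, a)] (by simp [Occurs, Tile.ends]; tauto)
      simp only [List.cons_append, List.nil_append] at h1 h2
      simp only [bracket, h1, h2]
      ring

theorem bracket_congr_swap (h : ∀ p ∈ P, p ∈ Q ∨ p.swap ∈ Q) (h' : ∀ p ∈ Q, p ∈ P ∨ p.swap ∈ P) :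
    bracket A D P = bracket A D Q := by
  have key : ∀ P Q M : List (ℕ × ℕ), (∀ p ∈ P, p ∈ Q ∨ p.swap ∈ Q) →
      ∀ p ∈ M ++ P, p ∈ M ++ Q ∨ p.swap ∈ M ++ Q := by
    intro P Q M h p hp
    rcases List.mem_append.1 hp with hp | hp
    · exact Or.inl (List.mem_append_left _ hp)
    · exact (h p hp).imp (List.mem_append_right _) (List.mem_append_right _)
  rw [bracket_congr (k := 0) fun M _ => numClasses_congr_swap (key P Q M h) (key Q P M h'),
    pow_zero, one_mul]

theorem bracket_cons (T : Tile) : bracket A (T :: D) P =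
    match T with
    | .point a b => bracket A D ([(a, b)] ++ P)
    | .crossing a b c d =>
      A * bracket A D ([(a, b), (c, d)] ++ P) + A⁻¹ * bracket A D ([(b, c), (d, a)] ++ P) := by
  cases T <;> rfl

theorem bracket_perm {D D' : Code} (h : D.Perm D') (P : List (ℕ × ℕ)) :
    bracket A D P = bracket A D' P := by
  induction h generalizing P with
  | nil => rfl
  | cons T _ ih =>
    rw [bracket_cons, bracket_cons]
    cases T <;> simp only [ih]
  | swap T T' D =>
    have hc : ∀ S S' : List (ℕ × ℕ),
        bracket A D (S ++ (S' ++ P)) = bracket A D (S' ++ (S ++ P)) := by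
      intro S S'
      apply bracket_congr_swap <;> intro p hp <;> left <;> simp only [List.mem_append] at hp ⊢ <;>
        tauto
    simp only [bracket_cons]
    cases T <;> cases T' <;> simp only [hc]
    ring
  | trans _ _ ih ih' => exact (ih P).trans (ih' P)

theorem bracket_rename (f : Equiv.Perm ℕ) :
    bracket A (D.map (Tile.map f)) (P.map (Prod.map f f)) = bracket A D P := by
  induction D generalizing P with
  | nil => simp only [List.map_nil, bracket, numClasses_map_perm]
  | cons T D ih => cases T <;> simp [Tile.map, bracket, ← ih]

/-- A pair of two arcs can be contracted, if this does not create a new circle without arcs. -/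
theorem bracket_merge {a b : ℕ} (h : a ∈ D.arcEnds ∨ Occurs P a) :
    bracket A D ((a, b) :: P) =
      bracket A (D.map (Tile.map (merge a b))) (P.map (Prod.map (merge a b) (merge a b))) := by
  induction D generalizing P with
  | nil =>
    simp only [Code.arcEnds, List.flatMap_nil, List.not_mem_nil, false_or] at h
    simp only [bracket, List.map_nil]
    rw [numClasses_cons_of_occurs (Or.inl h)]
  | cons T D ih =>
    have key : ∀ S, (a ∈ T.ends → Occurs S a) → bracket A D (S ++ (a, b) :: P) =
        bracket A (D.map (Tile.map (merge a b)))
          ((S ++ P).map (Prod.map (merge a b) (merge a b))) := by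
      intro S hS
      rw [← ih]
      · apply bracket_congr_swap <;> intro p hp <;> left <;>
          simp only [List.mem_append, List.mem_cons] at hp ⊢ <;> tauto
      · rw [Code.arcEnds, List.flatMap_cons, List.mem_append] at h
        rw [occurs_append]
        rcases h with (h | h) | h
        · exact Or.inr (Or.inl (hS h))
        · exact Or.inl h
        · exact Or.inr (Or.inr h)
    cases T with
    | point c d =>
      exact key [(c, d)] (by simp [Occurs, Tile.ends])
    | crossing c d e f =>
      have h1 := key [(c, d), (e, f)] (by simp [Occurs, Tile.ends]; tauto)
      have h2 := key [(d, e), (f, c)] (by simp [Occurs, Tile.ends]; tauto)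
      simp only [List.cons_append, List.nil_append, List.map_cons, Prod.map_apply] at h1 h2
      simp only [bracket, List.map_cons, Tile.map, h1, h2]

theorem bracket_circle {i : ℕ} (hD : i ∉ D.arcEnds) (hP : i ∉ P.flatMap fun p => [p.1, p.2]) :
    bracket A D ((i, i) :: P) = (-A ^ 2 - A⁻¹ ^ 2) * bracket A D P := by
  rw [bracket_congr (Q := P) (k := 1), pow_one]
  intro M hM
  rw [numClasses_perm List.perm_middle]
  have hi : ¬ Occurs (M ++ P) i := by
    rw [occurs_append]
    exact not_or.2 ⟨fun h => hD (hM i h), fun h => hP (occurs_iff.1 h)⟩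
  exact numClasses_cons_of_not_occurs hi hi

/-- The contraction of the first pair that contains `i`. -/
def contractPairs (i : ℕ) : List (ℕ × ℕ) → List (ℕ × ℕ)
  | [] => []
  | (a, b) :: P =>
    if a = i then P.map (Prod.map (merge b i) (merge b i))
    else if b = i then P.map (Prod.map (merge a i) (merge a i))
    else (a, b) :: contractPairs i P

/-- The pairs contain the path through `i` that is shortened by `contractPairs`. -/
def Contractible (i : ℕ) : List (ℕ × ℕ) → Prop
  | [] => False
  | (a, b) :: P =>
    if a = i then i ∈ P.flatMap fun p => [p.1, p.2]
    else if b = i then i ∈ P.flatMap fun p => [p.1, p.2]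
    else Contractible i P

theorem numClasses_contract {i : ℕ} (h : Contractible i P) {M : List (ℕ × ℕ)} (hM : ¬ Occurs M i) :
    numClasses (M ++ P) = numClasses (M ++ contractPairs i P) := by
  have hmerge : ∀ (M : List (ℕ × ℕ)) (x : ℕ), ¬ Occurs M i →
      M.map (Prod.map (merge x i) (merge x i)) = M := by
    intro M x hM
    refine (List.map_congr_left fun p hp => ?_).trans (List.map_id M)
    have h1 : p.1 ≠ i := fun h => hM ⟨p, hp, Or.inl h.symm⟩
    have h2 : p.2 ≠ i := fun h => hM ⟨p, hp, Or.inr h.symm⟩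
    simp [Prod.map, merge, h1, h2]
  have key : ∀ (x : ℕ) (M P : List (ℕ × ℕ)), ¬ Occurs M i → Occurs P i →
      numClasses ((x, i) :: (M ++ P)) =
        numClasses (M ++ P.map (Prod.map (merge x i) (merge x i))) := by
    intro x M P hM hP
    rw [numClasses_cons_of_occurs (Or.inr (occurs_append.2 (Or.inr hP))), List.map_append,
      hmerge M x hM]
  induction P generalizing M with
  | nil => exact h.elim
  | cons p P ih =>
    obtain ⟨a, b⟩ := p
    unfold Contractible at h
    unfold contractPairs
    split_ifs at h ⊢ with h1 h2
    · rw [← key b M P hM (occurs_iff.2 h), numClasses_perm List.perm_middle, numClasses_swap, h1]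
    · rw [← key a M P hM (occurs_iff.2 h), numClasses_perm List.perm_middle, h2]
    · have hM' : ¬ Occurs (M ++ [(a, b)]) i := by
        rw [occurs_append]
        refine not_or.2 ⟨hM, ?_⟩
        simp [Ne.symm h1, Ne.symm h2]
      have := ih h hM'
      simpa using this

theorem bracket_contract {i : ℕ} (hD : i ∉ D.arcEnds) (h : Contractible i P) :
    bracket A D P = bracket A D (contractPairs i P) := by
  rw [bracket_congr (k := 0) fun M hM => numClasses_contract h fun h => hD (hM i h), pow_zero,
    one_mul]

end bracket

/-! ### Invariance of the bracket under the Reidemeister moves -/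

/-- The condition on the arcs of a code. -/
def TwoEnds (D : Code) : Prop := ∀ x ∈ D.arcEnds, D.arcEnds.count x = 2

section moves

open Tile

variable {A : ℚ} {D D' : Code}

theorem TwoEnds.not_mem {x : ℕ} {R : List ℕ} (hD : TwoEnds D)
    (h : D.arcEnds.Perm (x :: x :: R)) : x ∉ R := by
  have h1 := hD x (h.mem_iff.2 (List.mem_cons_self ..))
  rw [h.count_eq] at h1
  exact List.count_eq_zero.1 (by simpa using h1)

theorem bracket_sameDiagram (hD : TwoEnds D) (h : SameDiagram D D') :
    bracket A D [] = bracket A D' [] := by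
  cases h with
  | perm h => exact bracket_perm h []
  | rotateCrossing a b c d L =>
    simp only [bracket]
    congr 2 <;> apply bracket_congr_swap <;> simp
  | rotatePoint a b L =>
    simp only [bracket]
    apply bracket_congr_swap <;> simp
  | rename f => exact (bracket_rename (P := []) f).symm
  | erase a b L hab =>
    have ha : a ∈ L.arcEnds := by
      have := hD a (by simp [Code.arcEnds, ends])
      simp only [Code.arcEnds, List.flatMap_cons, ends, List.cons_append, List.nil_append,
        List.count_cons_self, List.count_cons_of_ne hab.symm] at this
      exact List.count_pos_iff.1 (by rw [Code.arcEnds]; omega)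
    exact bracket_merge (P := []) (Or.inl ha)

/-- A kink changes the bracket only by a unit, so that no writhe is needed for an invariant up to
units. -/
theorem bracket_reidemeisterI (hA : A ≠ 0) (hD : TwoEnds D) (h : ReidemeisterI D D') :
    bracket A D [] = -A ^ 3 * bracket A D' [] ∨ bracket A D [] = -A⁻¹ ^ 3 * bracket A D' [] := by
  cases h with
  | kink a b c L =>
    left
    have ha := hD.not_mem (x := a) (R := b :: c :: L.arcEnds) (List.Perm.refl _)
    simp only [List.mem_cons, not_or] at ha
    obtain ⟨hab, hac, haL⟩ := ha
    have h1 : bracket A L [(a, a), (b, c)] = (-A ^ 2 - A⁻¹ ^ 2) * bracket A L [(b, c)] :=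
      bracket_circle haL (by simp [hab, hac])
    have h2 : bracket A L [(a, b), (c, a)] = bracket A L [(b, c)] := by
      rw [bracket_contract haL (by simp [Contractible])]
      apply bracket_congr_swap <;> simp [contractPairs, merge, Ne.symm hac]
    simp only [bracket, h1, h2]
    field_simp
    ring
  | kink' a b c L =>
    right
    have hb := hD.not_mem (x := b) (R := a :: c :: L.arcEnds) (by
      refine List.Perm.trans (l₂ := a :: b :: b :: c :: L.arcEnds) (List.Perm.refl _) ?_
      exact (List.Perm.swap ..).trans (.cons _ (List.Perm.swap ..)))
    simp only [List.mem_cons, not_or] at hb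
    obtain ⟨hba, hbc, hbL⟩ := hb
    have h1 : bracket A L [(b, b), (c, a)] = (-A ^ 2 - A⁻¹ ^ 2) * bracket A L [(a, c)] := by
      rw [bracket_circle hbL (by simp [hba, hbc])]
      congr 1
      apply bracket_congr_swap <;> simp
    have h2 : bracket A L [(a, b), (b, c)] = bracket A L [(a, c)] := by
      rw [bracket_contract hbL (by simp [Contractible, Ne.symm hba])]
      apply bracket_congr_swap <;> simp [contractPairs, merge, Ne.symm hba, Ne.symm hbc]
    simp only [bracket, h1, h2]
    field_simp
    ring

theorem bracket_reidemeisterII (hA : A ≠ 0) (hD : TwoEnds D) (h : ReidemeisterII D D') :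
    bracket A D [] = bracket A D' [] := by
  cases h with
  | bigon u o x y x' y' L =>
    have hu := hD.not_mem (x := u) (R := o :: x :: y :: x' :: o :: y' :: L.arcEnds)
      (.cons _ (List.perm_middle (l₁ := [o, x, y, x', o])))
    have ho := hD.not_mem (x := o) (R := u :: x :: y :: x' :: u :: y' :: L.arcEnds)
      ((List.perm_middle (l₁ := [u])).trans (.cons _ (List.perm_middle (l₁ := [u, x, y, x']))))
    simp only [List.mem_cons, not_or] at hu ho
    obtain ⟨huo, hux, huy, hux', -, huy', huL⟩ := hu
    obtain ⟨hou, hox, hoy, hox', -, hoy', hoL⟩ := ho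
    have hxo := Ne.symm hox
    have hxu := Ne.symm hux
    have hyo := Ne.symm hoy
    have hyu := Ne.symm huy
    have hxo' := Ne.symm hox'
    have hxu' := Ne.symm hux'
    have hyo' := Ne.symm hoy'
    have hyu' := Ne.symm huy'
    have hAA : bracket A L [(x', o), (u, y'), (u, o), (x, y)] = bracket A L [(x, y), (x', y')] := by
      rw [bracket_contract hoL (by simp [Contractible, *]),
        bracket_contract huL (by simp [Contractible, contractPairs, merge, *])]
      apply bracket_congr_swap <;> simp [contractPairs, merge, *]
    have hAB : bracket A L [(o, u), (y', x'), (u, o), (x, y)] =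
        (-A ^ 2 - A⁻¹ ^ 2) * bracket A L [(x, y), (x', y')] := by
      rw [bracket_contract hoL (by simp [Contractible, *])]
      have : bracket A L (contractPairs o [(o, u), (y', x'), (u, o), (x, y)]) =
          bracket A L [(u, u), (x, y), (x', y')] := by
        apply bracket_congr_swap <;> simp [contractPairs, merge, *]
      rw [this, bracket_circle huL (by simp [*])]
    have hBA : bracket A L [(x', o), (u, y'), (o, x), (y, u)] =
        bracket A L [(y, y'), (x, x')] := by
      rw [bracket_contract hoL (by simp [Contractible, *]),
        bracket_contract huL (by simp [Contractible, contractPairs, merge, *])]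
      apply bracket_congr_swap <;> simp [contractPairs, merge, *]
    have hBB : bracket A L [(o, u), (y', x'), (o, x), (y, u)] =
        bracket A L [(x, y), (x', y')] := by
      rw [bracket_contract hoL (by simp [Contractible, *]),
        bracket_contract huL (by simp [Contractible, contractPairs, merge, *])]
      apply bracket_congr_swap <;> simp [contractPairs, merge, *]
    simp only [bracket, hAA, hAB, hBA, hBB]
    field_simp
    ring

theorem TwoEnds.of_perm (hD : TwoEnds D) (h : D.arcEnds.Perm D'.arcEnds) : TwoEnds D' := by
  intro x hx
  rw [← h.count_eq]
  exact hD x (h.mem_iff.2 hx)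

theorem arcEnds_mirror (D : Code) : (Code.arcEnds (D.map mirror)).Perm D.arcEnds := by
  unfold Code.arcEnds
  rw [List.flatMap_map]
  refine List.Perm.flatMap_left _ fun T _ => ?_
  cases T with
  | point a b => exact .refl _
  | crossing a b c d => exact (List.perm_append_comm (l₁ := [a]) (l₂ := [b, c, d])).symm

theorem TwoEnds.mirror (hD : TwoEnds D) : TwoEnds (D.map mirror) :=
  hD.of_perm (arcEnds_mirror D).symm

/-- Changing all crossings amounts to the exchange of `A` and `A⁻¹`. -/
theorem bracket_mirror (D : Code) (P : List (ℕ × ℕ)) :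
    bracket A (D.map mirror) P = bracket A⁻¹ D P := by
  induction D generalizing P with
  | nil =>
    simp only [List.map_nil, bracket, inv_inv]
    congr 1
    ring
  | cons T D ih =>
    cases T with
    | point a b => exact ih _
    | crossing a b c d =>
      have h : bracket A⁻¹ D ((c, d) :: (a, b) :: P) = bracket A⁻¹ D ((a, b) :: (c, d) :: P) := by
        apply bracket_congr_swap <;> simp +contextual
      simp only [List.map_cons, Tile.mirror, bracket, ih, inv_inv, h]
      ring

theorem bracket_rotateCrossing (a b c d : ℕ) (D : Code) (P : List (ℕ × ℕ)) :
    bracket A (crossing a b c d :: D) P = bracket A (crossing c d a b :: D) P := by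
  simp only [bracket]
  congr 2 <;> apply bracket_congr_swap <;> simp +contextual

theorem bracket_cons_congr (h : ∀ P, bracket A D P = bracket A D' P) (T : Tile)
    (P : List (ℕ × ℕ)) : bracket A (T :: D) P = bracket A (T :: D') P := by
  cases T <;> simp only [bracket, h]

/-- Invariance under the Reidemeister III move: each of the eight states on either side reduces to one
of the five planar matchings of the six boundary points, for one state with an additional circle. -/
theorem bracket_triangle (hA : A ≠ 0) (p₁ p₂ p₃ p₄ p₅ p₆ i₁ i₂ i₃ : ℕ) (L : Code)
    (hD : TwoEnds (crossing p₂ i₁ i₂ p₁ :: crossing p₃ p₄ i₃ i₁ :: crossing p₆ i₂ i₃ p₅ :: L)) :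
    bracket A (crossing p₂ i₁ i₂ p₁ :: crossing p₃ p₄ i₃ i₁ :: crossing p₆ i₂ i₃ p₅ :: L) [] =
      bracket A (crossing p₃ i₂ i₃ p₂ :: crossing p₅ i₁ i₂ p₄ :: crossing p₆ p₁ i₃ i₁ :: L) [] := by
  have h1 := hD.not_mem (x := i₁)
    (R := p₂ :: i₂ :: p₁ :: p₃ :: p₄ :: i₃ :: p₆ :: i₂ :: i₃ :: p₅ :: L.arcEnds)
    ((List.perm_middle (l₁ := [p₂])).trans
      (.cons _ (List.perm_middle (l₁ := [p₂, i₂, p₁, p₃, p₄, i₃]))))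
  have h2 := hD.not_mem (x := i₂)
    (R := p₂ :: i₁ :: p₁ :: p₃ :: p₄ :: i₃ :: i₁ :: p₆ :: i₃ :: p₅ :: L.arcEnds)
    ((List.perm_middle (l₁ := [p₂, i₁])).trans
      (.cons _ (List.perm_middle (l₁ := [p₂, i₁, p₁, p₃, p₄, i₃, i₁, p₆]))))
  have h3 := hD.not_mem (x := i₃)
    (R := p₂ :: i₁ :: i₂ :: p₁ :: p₃ :: p₄ :: i₁ :: p₆ :: i₂ :: p₅ :: L.arcEnds)
    ((List.perm_middle (l₁ := [p₂, i₁, i₂, p₁, p₃, p₄])).trans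
      (.cons _ (List.perm_middle (l₁ := [p₂, i₁, i₂, p₁, p₃, p₄, i₁, p₆, i₂]))))
  simp only [List.mem_cons, not_or] at h1 h2 h3
  obtain ⟨h12, h1i2, h11, h13, h14, h1i3, h16, -, -, h15, h1L⟩ := h1
  obtain ⟨h22, h2i1, h21, h23, h24, h2i3, -, h26, -, h25, h2L⟩ := h2
  obtain ⟨h32, h3i1, h3i2, h31, h33, h34, -, h36, -, h35, h3L⟩ := h3
  have h11' := Ne.symm h11
  have h12' := Ne.symm h12
  have h13' := Ne.symm h13
  have h14' := Ne.symm h14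
  have h15' := Ne.symm h15
  have h16' := Ne.symm h16
  have h21' := Ne.symm h21
  have h22' := Ne.symm h22
  have h23' := Ne.symm h23
  have h24' := Ne.symm h24
  have h25' := Ne.symm h25
  have h26' := Ne.symm h26
  have h31' := Ne.symm h31
  have h32' := Ne.symm h32
  have h33' := Ne.symm h33
  have h34' := Ne.symm h34
  have h35' := Ne.symm h35
  have h36' := Ne.symm h36
  have hb : bracket A L [(p₆, i₂), (i₃, p₅), (p₃, p₄), (i₃, i₁), (p₂, i₁), (i₂, p₁)] =
        bracket A L [(p₁, p₆), (p₂, p₅), (p₃, p₄)] ∧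
      bracket A L [(i₂, i₃), (p₅, p₆), (p₃, p₄), (i₃, i₁), (p₂, i₁), (i₂, p₁)] =
        bracket A L [(p₁, p₂), (p₃, p₄), (p₅, p₆)] ∧
      bracket A L [(p₆, i₂), (i₃, p₅), (p₄, i₃), (i₁, p₃), (p₂, i₁), (i₂, p₁)] =
        bracket A L [(p₁, p₆), (p₂, p₃), (p₄, p₅)] ∧
      bracket A L [(i₂, i₃), (p₅, p₆), (p₄, i₃), (i₁, p₃), (p₂, i₁), (i₂, p₁)] =
        bracket A L [(p₁, p₄), (p₂, p₃), (p₅, p₆)] ∧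
      bracket A L [(p₆, i₂), (i₃, p₅), (p₃, p₄), (i₃, i₁), (i₁, i₂), (p₁, p₂)] =
        bracket A L [(p₁, p₂), (p₃, p₄), (p₅, p₆)] ∧
      bracket A L [(p₆, i₂), (i₃, p₅), (p₄, i₃), (i₁, p₃), (i₁, i₂), (p₁, p₂)] =
        bracket A L [(p₁, p₂), (p₃, p₆), (p₄, p₅)] ∧
      bracket A L [(i₂, i₃), (p₅, p₆), (p₄, i₃), (i₁, p₃), (i₁, i₂), (p₁, p₂)] =
        bracket A L [(p₁, p₂), (p₃, p₄), (p₅, p₆)] := by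
    refine ⟨?_, ?_, ?_, ?_, ?_, ?_, ?_⟩ <;>
    · rw [bracket_contract h1L (by simp [Contractible, *]),
        bracket_contract h2L (by simp [Contractible, contractPairs, merge, *]),
        bracket_contract h3L (by simp [Contractible, contractPairs, merge, *])]
      apply bracket_congr_swap <;> simp [contractPairs, merge, *]
  have cb : bracket A L [(i₂, i₃), (p₅, p₆), (p₃, p₄), (i₃, i₁), (i₁, i₂), (p₁, p₂)] =
      (-A ^ 2 - A⁻¹ ^ 2) * bracket A L [(p₁, p₂), (p₃, p₄), (p₅, p₆)] := by
    rw [bracket_contract h1L (by simp [Contractible, *]),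
      bracket_contract h2L (by simp [Contractible, contractPairs, merge, *])]
    rw [← bracket_circle h3L (by simp [*])]
    apply bracket_congr_swap <;> simp [contractPairs, merge, *]
  have ha : bracket A L [(p₆, p₁), (i₃, i₁), (p₅, i₁), (i₂, p₄), (p₃, i₂), (i₃, p₂)] =
        bracket A L [(p₁, p₆), (p₂, p₅), (p₃, p₄)] ∧
      bracket A L [(p₁, i₃), (i₁, p₆), (p₅, i₁), (i₂, p₄), (p₃, i₂), (i₃, p₂)] =
        bracket A L [(p₁, p₂), (p₃, p₄), (p₅, p₆)] ∧
      bracket A L [(p₆, p₁), (i₃, i₁), (i₁, i₂), (p₄, p₅), (p₃, i₂), (i₃, p₂)] =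
        bracket A L [(p₁, p₆), (p₂, p₃), (p₄, p₅)] ∧
      bracket A L [(p₁, i₃), (i₁, p₆), (i₁, i₂), (p₄, p₅), (p₃, i₂), (i₃, p₂)] =
        bracket A L [(p₁, p₂), (p₃, p₆), (p₄, p₅)] ∧
      bracket A L [(p₆, p₁), (i₃, i₁), (p₅, i₁), (i₂, p₄), (i₂, i₃), (p₂, p₃)] =
        bracket A L [(p₁, p₆), (p₂, p₃), (p₄, p₅)] ∧
      bracket A L [(p₁, i₃), (i₁, p₆), (p₅, i₁), (i₂, p₄), (i₂, i₃), (p₂, p₃)] =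
        bracket A L [(p₁, p₄), (p₂, p₃), (p₅, p₆)] ∧
      bracket A L [(p₁, i₃), (i₁, p₆), (i₁, i₂), (p₄, p₅), (i₂, i₃), (p₂, p₃)] =
        bracket A L [(p₁, p₆), (p₂, p₃), (p₄, p₅)] := by
    refine ⟨?_, ?_, ?_, ?_, ?_, ?_, ?_⟩ <;>
    · rw [bracket_contract h1L (by simp [Contractible, *]),
        bracket_contract h2L (by simp [Contractible, contractPairs, merge, *]),
        bracket_contract h3L (by simp [Contractible, contractPairs, merge, *])]
      apply bracket_congr_swap <;> simp [contractPairs, merge, *]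
  have ca : bracket A L [(p₆, p₁), (i₃, i₁), (i₁, i₂), (p₄, p₅), (i₂, i₃), (p₂, p₃)] =
      (-A ^ 2 - A⁻¹ ^ 2) * bracket A L [(p₁, p₆), (p₂, p₃), (p₄, p₅)] := by
    rw [bracket_contract h1L (by simp [Contractible, *]),
      bracket_contract h2L (by simp [Contractible, contractPairs, merge, *])]
    rw [← bracket_circle h3L (by simp [*])]
    apply bracket_congr_swap <;> simp [contractPairs, merge, *]
  obtain ⟨b₁, b₂, b₃, b₄, b₅, b₆, b₇⟩ := hb
  obtain ⟨a₁, a₂, a₃, a₄, a₅, a₆, a₇⟩ := ha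
  simp only [bracket, b₁, b₂, b₃, b₄, b₅, b₆, b₇, cb, a₁, a₂, a₃, a₄, a₅, a₆, a₇, ca]
  field_simp
  ring

theorem bracket_reidemeisterIII (hA : A ≠ 0) (hD : TwoEnds D) (h : ReidemeisterIII D D') :
    bracket A D [] = bracket A D' [] := by
  cases h with
  | down => exact bracket_triangle hA _ _ _ _ _ _ _ _ _ _ hD
  | up p₁ p₂ p₃ p₄ p₅ p₆ i₁ i₂ i₃ L =>
    -- The mirror image of this move is the one of the other case.
    have hA' := bracket_triangle (inv_ne_zero hA) p₁ p₂ p₃ p₄ p₅ p₆ i₁ i₂ i₃ (L.map mirror)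
      (hD.mirror.of_perm (List.Perm.append_left [p₂, i₁, i₂, p₁]
        (List.Perm.append_right _ (List.perm_append_comm (l₁ := [i₃, i₁]) (l₂ := [p₃, p₄])))))
    have mir : ∀ D : Code, bracket A D [] = bracket A⁻¹ (D.map mirror) [] := by
      intro D
      rw [bracket_mirror, inv_inv]
    rw [mir, mir]
    refine (bracket_cons_congr (bracket_rotateCrossing i₃ i₁ p₃ p₄ _) _ _).trans (hA'.trans ?_)
    exact bracket_cons_congr (bracket_cons_congr (bracket_rotateCrossing p₆ p₁ i₃ i₁ _) _) _ _

end moves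

/-! ### Diagrams of Turaev genus zero -/

theorem numClasses_le {L L' : List (ℕ × ℕ)} (ho : ∀ x, Occurs L x ↔ Occurs L' x)
    (h : ∀ p ∈ L, Conn L' p.1 p.2) : numClasses L' ≤ numClasses L := by
  refine Nat.card_le_card_of_surjective
    (Quot.lift (fun x => Quot.mk _ ⟨x.1, (ho _).1 x.2⟩) ?_) ?_
  · intro x y hxy
    exact (quot_mk_eq_iff_conn _ _).2 (h _ hxy)
  · rintro ⟨x⟩
    exact ⟨Quot.mk _ ⟨x.1, (ho _).2 x.2⟩, rfl⟩

/-- Four ends `a`, `b`, `c`, `d` can be joined in two ways or all together.  If the components of the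
rest contain an even number of these ends, then at most one of the two ways gives more components
than the other one, and then one more. -/
theorem numClasses_smoothings {M : List (ℕ × ℕ)} {a b c d : ℕ}
    (hM : ∀ S : ℕ → Prop, (∀ p ∈ M, S p.1 ↔ S p.2) → ((S a ↔ S b) ↔ (S c ↔ S d))) :
    (Conn ((a, b) :: (c, d) :: M) b c ∧ Conn ((b, c) :: (d, a) :: M) a b ∧
      numClasses ((a, b) :: (c, d) :: M) =
        numClasses ((a, b) :: (c, d) :: (b, c) :: (d, a) :: M) ∧
      numClasses ((b, c) :: (d, a) :: M) =
        numClasses ((a, b) :: (c, d) :: (b, c) :: (d, a) :: M)) ∨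
    (¬ Conn ((a, b) :: (c, d) :: M) b c ∧ Conn ((b, c) :: (d, a) :: M) a b ∧
      numClasses ((a, b) :: (c, d) :: M) =
        numClasses ((a, b) :: (c, d) :: (b, c) :: (d, a) :: M) + 1 ∧
      numClasses ((b, c) :: (d, a) :: M) =
        numClasses ((a, b) :: (c, d) :: (b, c) :: (d, a) :: M)) ∨
    (Conn ((a, b) :: (c, d) :: M) b c ∧ ¬ Conn ((b, c) :: (d, a) :: M) a b ∧
      numClasses ((a, b) :: (c, d) :: M) =
        numClasses ((a, b) :: (c, d) :: (b, c) :: (d, a) :: M) ∧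
      numClasses ((b, c) :: (d, a) :: M) =
        numClasses ((a, b) :: (c, d) :: (b, c) :: (d, a) :: M) + 1) := by
  have hX : numClasses ((b, c) :: (a, b) :: (c, d) :: M) =
      numClasses ((a, b) :: (c, d) :: (b, c) :: (d, a) :: M) := by
    refine numClasses_congr (fun x => ?_) ?_ ?_
    · simp only [occurs_cons]
      generalize Occurs M x = q
      tauto
    · intro p hp
      refine .of_mem ?_
      simp only [List.mem_cons] at hp ⊢
      tauto
    · intro p hp
      simp only [List.mem_cons] at hp
      rcases hp with rfl | rfl | rfl | rfl | hp
      · exact .of_mem (by simp)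
      · exact .of_mem (by simp)
      · exact .of_mem (by simp)
      · have h1 : Conn ((b, c) :: (a, b) :: (c, d) :: M) a b := .of_mem (by simp)
        have h2 : Conn ((b, c) :: (a, b) :: (c, d) :: M) b c := .of_mem (by simp)
        have h3 : Conn ((b, c) :: (a, b) :: (c, d) :: M) c d := .of_mem (by simp)
        exact ((h1.trans h2).trans h3).symm
      · exact .of_mem (by simp [hp])
  have hY : numClasses ((a, b) :: (b, c) :: (d, a) :: M) =
      numClasses ((a, b) :: (c, d) :: (b, c) :: (d, a) :: M) := by
    refine numClasses_congr (fun x => ?_) ?_ ?_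
    · simp only [occurs_cons]
      generalize Occurs M x = q
      tauto
    · intro p hp
      refine .of_mem ?_
      simp only [List.mem_cons] at hp ⊢
      tauto
    · intro p hp
      simp only [List.mem_cons] at hp
      rcases hp with rfl | rfl | rfl | rfl | hp
      · exact .of_mem (by simp)
      · have h1 : Conn ((a, b) :: (b, c) :: (d, a) :: M) a b := .of_mem (by simp)
        have h2 : Conn ((a, b) :: (b, c) :: (d, a) :: M) b c := .of_mem (by simp)
        have h3 : Conn ((a, b) :: (b, c) :: (d, a) :: M) d a := .of_mem (by simp)
        exact ((h3.trans h1).trans h2).symm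
      · exact .of_mem (by simp)
      · exact .of_mem (by simp)
      · exact .of_mem (by simp [hp])
  have par : Conn ((a, b) :: (c, d) :: M) b c ∨ Conn ((b, c) :: (d, a) :: M) a b := by
    have key := hM (Conn M a) fun p hp => ⟨fun h => h.trans (.of_mem hp),
      fun h => h.trans (Conn.of_mem hp).symm⟩
    have sX : M ⊆ (a, b) :: (c, d) :: M := fun p hp => by simp [hp]
    have sY : M ⊆ (b, c) :: (d, a) :: M := fun p hp => by simp [hp]
    have hab : Conn ((a, b) :: (c, d) :: M) a b := .of_mem (by simp)
    have hcd : Conn ((a, b) :: (c, d) :: M) c d := .of_mem (by simp)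
    by_cases h1 : Conn M a b
    · exact Or.inr (h1.of_subset sY)
    · left
      have h0 : Conn M a a := .refl a
      by_cases h2 : Conn M a c
      · exact hab.symm.trans (h2.of_subset sX)
      · by_cases h3 : Conn M a d
        · exact hab.symm.trans ((h3.of_subset sX).trans hcd.symm)
        · exact absurd (key.2 (by simp [h2, h3])) (by simp [h0, h1])
  have oX : ∀ x, x = a ∨ x = b ∨ x = c ∨ x = d → Occurs ((a, b) :: (c, d) :: M) x := by
    intro x hx
    simp only [occurs_cons]
    tauto
  have oY : ∀ x, x = a ∨ x = b ∨ x = c ∨ x = d → Occurs ((b, c) :: (d, a) :: M) x := by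
    intro x hx
    simp only [occurs_cons]
    tauto
  have ob := oX b (by simp)
  have oc := oX c (by simp)
  have oa' := oY a (by simp)
  have ob' := oY b (by simp)
  by_cases h1 : Conn ((a, b) :: (c, d) :: M) b c
  · have e1 := hX ▸ numClasses_cons_of_conn ob oc h1
    by_cases h2 : Conn ((b, c) :: (d, a) :: M) a b
    · have e2 := hY ▸ numClasses_cons_of_conn oa' ob' h2
      exact Or.inl ⟨h1, h2, e1.symm, e2.symm⟩
    · have e2 := hY ▸ numClasses_cons_of_not_conn oa' ob' h2
      exact Or.inr (Or.inr ⟨h1, h2, e1.symm, e2⟩)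
  · have h2 := par.resolve_left h1
    have e1 := hX ▸ numClasses_cons_of_not_conn ob oc h1
    have e2 := hY ▸ numClasses_cons_of_conn oa' ob' h2
    exact Or.inr (Or.inl ⟨h1, h2, e1, e2.symm⟩)

/-- Every set of arcs contains an even number of the ends in `D` and `P`. -/
def EvenEnds (D : Code) (P : List (ℕ × ℕ)) : Prop :=
  ∀ S : ℕ → Bool, Even ((D.arcEnds ++ P.flatMap fun p => [p.1, p.2]).countP S)

theorem TwoEnds.evenEnds {D : Code} (hD : TwoEnds D) : EvenEnds D [] := by
  intro S
  rw [List.flatMap_nil, List.append_nil, List.countP_eq_length_filter,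
    ← List.sum_toFinset_count_eq_length]
  refine Finset.even_sum _ fun x hx => ?_
  have hx' := List.mem_filter.1 (List.mem_toFinset.1 hx)
  rw [List.count_filter hx'.2, hD x hx'.1]
  exact even_two

namespace EvenEnds

variable {D D' : Code} {P : List (ℕ × ℕ)} {a b c d : ℕ}

theorem of_perm {P' : List (ℕ × ℕ)} (h : EvenEnds D P)
    (hp : (D.arcEnds ++ P.flatMap fun p => [p.1, p.2]).Perm
      (D'.arcEnds ++ P'.flatMap fun p => [p.1, p.2])) : EvenEnds D' P' := fun S => by
  rw [← hp.countP_eq]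
  exact h S

theorem perm (h : EvenEnds D P) (hD : D.Perm D') : EvenEnds D' P :=
  h.of_perm (List.Perm.append_right _ (hD.flatMap_right Tile.ends))

theorem point (h : EvenEnds (.point a b :: D) P) : EvenEnds D ((a, b) :: P) :=
  h.of_perm (List.perm_append_comm_assoc [a, b] D.arcEnds _)

theorem smoothA (h : EvenEnds (.crossing a b c d :: D) P) :
    EvenEnds D ((a, b) :: (c, d) :: P) :=
  h.of_perm (List.perm_append_comm_assoc [a, b, c, d] D.arcEnds _)

theorem smoothB (h : EvenEnds (.crossing a b c d :: D) P) :
    EvenEnds D ((b, c) :: (d, a) :: P) :=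
  smoothA (h.of_perm (List.Perm.append_right _ (List.Perm.append_right D.arcEnds
    (List.perm_append_comm (l₁ := [a]) (l₂ := [b, c, d])))))

/-- If the pairs of `M` connect the ends in `D` and `P` except `a`, `b`, `c` and `d`, then a component
of `M` contains an even number of these four ends. -/
theorem component (h : EvenEnds D ((a, b) :: (c, d) :: P)) {N : List (ℕ × ℕ)}
    (hN : (N.flatMap fun p => [p.1, p.2]).Perm D.arcEnds) {S : ℕ → Prop}
    (hS : ∀ p ∈ N ++ P, S p.1 ↔ S p.2) : (S a ↔ S b) ↔ (S c ↔ S d) := by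
  classical
  have key : ∀ L : List (ℕ × ℕ), (∀ p ∈ L, S p.1 ↔ S p.2) →
      Even ((L.flatMap fun p => [p.1, p.2]).countP (S ·)) := by
    intro L hL
    induction L with
    | nil => simp
    | cons p L ih =>
      have := ih fun q hq => hL q (List.mem_cons_of_mem _ hq)
      have hp := hL p (List.mem_cons_self ..)
      simp only [List.flatMap_cons, List.countP_append]
      refine Even.add ?_ this
      by_cases h' : S p.2 <;> simp [hp, h']
  have h1 := key N fun p hp => hS p (List.mem_append_left _ hp)
  have h2 := key P fun p hp => hS p (List.mem_append_right _ hp)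
  have h3 := h (S ·)
  rw [hN.countP_eq] at h1
  rw [List.countP_append, List.flatMap_cons, List.flatMap_cons, List.countP_append,
    List.countP_append] at h3
  have h4 := (Nat.even_add.1 h3).1 h1
  rw [← add_assoc] at h4
  have h5 := (Nat.even_add.1 h4).2 h2
  by_cases ha : S a <;> by_cases hb : S b <;> by_cases hc : S c <;> by_cases hd : S d <;>
    simp [ha, hb, hc, hd] at h5 ⊢ <;> exact absurd h5 (by decide)

end EvenEnds

namespace Code

variable {D D' : Code} {P : List (ℕ × ℕ)} {a b c d : ℕ}

/-- The number of circles of the all-A state, with the pairs of `P` added. -/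
noncomputable def circlesA (D : Code) (P : List (ℕ × ℕ)) : ℕ :=
  numClasses (D.flatMap Tile.smoothA ++ P)

/-- The number of circles of the all-B state, with the pairs of `P` added. -/
noncomputable def circlesB (D : Code) (P : List (ℕ × ℕ)) : ℕ :=
  numClasses (D.flatMap Tile.smoothB ++ P)

/-- The number of components of the projection, with the pairs of `P` added. -/
noncomputable def numParts (D : Code) (P : List (ℕ × ℕ)) : ℕ :=
  numClasses (D.flatMap (fun T => T.smoothA ++ T.smoothB) ++ P)

theorem perm_ends_smoothA (D : Code) :
    ((D.flatMap Tile.smoothA).flatMap fun p => [p.1, p.2]).Perm D.arcEnds := by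
  rw [List.flatMap_assoc, arcEnds]
  refine List.Perm.flatMap_left _ fun T _ => ?_
  cases T <;> exact .refl _

theorem perm_ends_smoothB (D : Code) :
    ((D.flatMap Tile.smoothB).flatMap fun p => [p.1, p.2]).Perm D.arcEnds := by
  rw [List.flatMap_assoc, arcEnds]
  refine List.Perm.flatMap_left _ fun T _ => ?_
  cases T with
  | point a b => exact .refl _
  | crossing a b c d => exact (List.perm_append_comm (l₁ := [a]) (l₂ := [b, c, d])).symm

theorem circlesA_crossing :
    circlesA (.crossing a b c d :: D) P = circlesA D ((a, b) :: (c, d) :: P) :=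
  numClasses_perm (List.perm_append_comm_assoc [(a, b), (c, d)] _ _)

theorem circlesB_crossing :
    circlesB (.crossing a b c d :: D) P = circlesB D ((b, c) :: (d, a) :: P) :=
  numClasses_perm (List.perm_append_comm_assoc [(b, c), (d, a)] _ _)

theorem circlesA_point : circlesA (.point a b :: D) P = circlesA D ((a, b) :: P) :=
  numClasses_perm (List.perm_append_comm_assoc [(a, b)] _ _)

theorem circlesB_point : circlesB (.point a b :: D) P = circlesB D ((a, b) :: P) :=
  numClasses_perm (List.perm_append_comm_assoc [(a, b)] _ _)

theorem numParts_point : numParts (.point a b :: D) P = numParts D ((a, b) :: P) := by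
  apply numClasses_congr_swap <;> intro p hp <;> left <;>
    simp only [List.flatMap_cons, Tile.smoothA, Tile.smoothB, List.mem_append, List.mem_cons,
      List.not_mem_nil] at hp ⊢ <;> tauto

theorem circlesA_perm (h : D.Perm D') : circlesA D P = circlesA D' P :=
  numClasses_perm ((h.flatMap_right _).append_right P)

theorem circlesB_perm (h : D.Perm D') : circlesB D P = circlesB D' P :=
  numClasses_perm ((h.flatMap_right _).append_right P)

theorem numParts_perm (h : D.Perm D') : numParts D P = numParts D' P :=
  numClasses_perm ((h.flatMap_right _).append_right P)

theorem numCrossings_perm (h : D.Perm D') : D.numCrossings = D'.numCrossings :=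
  (h.flatMap_right _).length_eq

theorem numCrossings_point : numCrossings (.point a b :: D) = D.numCrossings := rfl

theorem numCrossings_crossing :
    numCrossings (.crossing a b c d :: D) = D.numCrossings + 1 := by
  simp [numCrossings, Tile.band?]

theorem circlesA_cons_cons (p q : ℕ × ℕ) :
    circlesA D (p :: q :: P) = numClasses (p :: q :: (D.flatMap Tile.smoothA ++ P)) :=
  numClasses_perm (List.perm_append_comm_assoc _ [p, q] _)

theorem circlesB_cons_cons (p q : ℕ × ℕ) :
    circlesB D (p :: q :: P) = numClasses (p :: q :: (D.flatMap Tile.smoothB ++ P)) :=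
  numClasses_perm (List.perm_append_comm_assoc _ [p, q] _)

theorem numParts_cons_cons (p q : ℕ × ℕ) :
    numParts D (p :: q :: P) =
      numClasses (p :: q :: (D.flatMap (fun T => T.smoothA ++ T.smoothB) ++ P)) :=
  numClasses_perm (List.perm_append_comm_assoc _ [p, q] _)

/-- A set of arcs that is closed for larger smoothings is closed for the all-A state. -/
theorem closed_of_closed {f : Tile → List (ℕ × ℕ)} (hf : ∀ T, T.smoothA ⊆ f T) {S : ℕ → Prop}
    (hS : ∀ p ∈ D.flatMap f ++ P, S p.1 ↔ S p.2) :
    ∀ p ∈ D.flatMap Tile.smoothA ++ P, S p.1 ↔ S p.2 := by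
  intro p hp
  refine hS p ?_
  rcases List.mem_append.1 hp with hp | hp
  · obtain ⟨T, hT, hp⟩ := List.mem_flatMap.1 hp
    exact List.mem_append_left _ (List.mem_flatMap.2 ⟨T, hT, hf T hp⟩)
  · exact List.mem_append_right _ hp

/-- The Euler characteristic of the Turaev surface is at most `2` for every component. -/
theorem circlesA_add_circlesB_le (h : EvenEnds D P) :
    D.circlesA P + D.circlesB P ≤ D.numCrossings + 2 * D.numParts P := by
  induction D generalizing P with
  | nil => simp [circlesA, circlesB, numParts, two_mul]
  | cons T D ih =>
    cases T with
    | point a b =>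
      rw [circlesA_point, circlesB_point, numParts_point, numCrossings_point]
      exact ih h.point
    | crossing a b c d =>
      have hA := ih h.smoothA
      have hB := ih h.smoothB
      have tA := numClasses_smoothings fun S hS => h.smoothA.component (perm_ends_smoothA D) hS
      have tB := numClasses_smoothings fun S hS => h.smoothA.component (perm_ends_smoothB D) hS
      have tT := numClasses_smoothings fun S
        (hS : ∀ p ∈ D.flatMap (fun T => T.smoothA ++ T.smoothB) ++ P, S p.1 ↔ S p.2) =>
        h.smoothA.component (perm_ends_smoothA D)
          (closed_of_closed (fun T => List.subset_append_left _ _) hS)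
      rw [circlesA_cons_cons, circlesB_cons_cons, numParts_cons_cons] at hA hB
      rw [numCrossings_crossing, circlesA_crossing, circlesB_crossing, circlesA_cons_cons,
        circlesB_cons_cons]
      change _ ≤ _ + 2 * numClasses ((a, b) :: (c, d) :: (b, c) :: (d, a) ::
        (D.flatMap (fun T => T.smoothA ++ T.smoothB) ++ P))
      omega

end Code

/-- If the B-smoothing of a crossing separates its ends `b`, `c` from its ends `d`, `a`, then the
crossing is nugatory: the B-smoothing gives the distant union of two diagrams and the A-smoothing
their connected sum, which has one circle less in every state. -/
theorem bracket_smoothB_of_split {A : ℚ} {D : Code} {P : List (ℕ × ℕ)} {a b c d : ℕ}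
    (h : EvenEnds D ((a, b) :: (c, d) :: P))
    (hs : ¬ Conn ((b, c) :: (d, a) :: (D.flatMap (fun T => T.smoothA ++ T.smoothB) ++ P)) a b) :
    bracket A D ((b, c) :: (d, a) :: P) =
      (-A ^ 2 - A⁻¹ ^ 2) * bracket A D ((a, b) :: (c, d) :: P) := by
  induction D generalizing P with
  | nil =>
    have t := numClasses_smoothings fun S hS =>
      h.component (N := []) (List.Perm.refl _) (S := S) hS
    have e : numClasses ((b, c) :: (d, a) :: P) = numClasses ((a, b) :: (c, d) :: P) + 1 := by
      rcases t with t | t | t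
      · exact absurd t.2.1 hs
      · exact absurd t.2.1 hs
      · exact t.2.2.2.trans (congrArg (· + 1) t.2.2.1.symm)
    simp only [bracket, e, pow_succ']
  | cons T D ih =>
    have key : ∀ S : List (ℕ × ℕ), S ⊆ T.smoothA ++ T.smoothB →
        (S.flatMap fun p => [p.1, p.2]).Perm T.ends →
        bracket A D (S ++ (b, c) :: (d, a) :: P) =
          (-A ^ 2 - A⁻¹ ^ 2) * bracket A D (S ++ (a, b) :: (c, d) :: P) := by
      intro S hS hS'
      have comm : ∀ p q : ℕ × ℕ, bracket A D (S ++ p :: q :: P) =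
          bracket A D (p :: q :: (S ++ P)) := by
        intro p q
        apply bracket_congr_swap <;> intro r hr <;> left <;>
          simp only [List.mem_append, List.mem_cons] at hr ⊢ <;> tauto
      rw [comm, comm]
      refine ih ?_ ?_
      · refine h.of_perm ?_
        simp only [Code.arcEnds, List.flatMap_cons, List.flatMap_append]
        rw [List.perm_iff_count]
        intro x
        have := hS'.count_eq x
        simp only [List.count_append]
        omega
      · refine fun h' => hs (h'.of_subset ?_)
        intro p hp
        simp only [List.mem_append, List.mem_cons, List.flatMap_cons] at hp ⊢
        have := @hS p
        simp only [List.mem_append] at this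
        tauto
    cases T with
    | point x y => exact key [(x, y)] (by simp [Tile.smoothA]) (.refl _)
    | crossing x y z w =>
      have h1 := key [(x, y), (z, w)] (by simp [Tile.smoothA]) (.refl _)
      have h2 := key [(y, z), (w, x)] (by simp [Tile.smoothA, Tile.smoothB])
        (List.perm_append_comm (l₁ := [x]) (l₂ := [y, z, w])).symm
      simp only [List.cons_append, List.nil_append] at h1 h2
      simp only [bracket, h1, h2]
      ring

/-- The number `x` is `±1` modulo `5` up to a power of `5`.  For the value of a Laurent polynomial in
`A` with integral coefficients at `A = 5` or `A = 1 / 5` this is a condition on the lowest or the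
highest coefficient, which holds if that coefficient is `±1`. -/
def UnitLead (x : ℚ) : Prop := ∃ m k : ℤ, 5 ∣ k ^ 2 - 1 ∧ x = 5 ^ m * k

theorem UnitLead.neg_zpow_mul {x : ℚ} (h : UnitLead x) (j : ℤ) : UnitLead (-5 ^ j * x) := by
  obtain ⟨m, k, hk, rfl⟩ := h
  refine ⟨j + m, -k, by simpa using hk, ?_⟩
  rw [zpow_add₀ (by norm_num)]
  push_cast
  ring

theorem unitLead_neg_zpow_mul {x : ℚ} (j : ℤ) : UnitLead (-5 ^ j * x) ↔ UnitLead x := by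
  refine ⟨fun h => ?_, fun h => h.neg_zpow_mul j⟩
  have h' := h.neg_zpow_mul (-j)
  have : (-5 ^ (-j) * (-5 ^ j * x) : ℚ) = x := by
    rw [zpow_neg]
    field_simp
  rwa [this] at h'

namespace Code

variable {D : Code} {P : List (ℕ × ℕ)}

/-- At `A = 1 / 5`, the summands of the bracket are integral multiples of the power of `5` that
belongs to the all-A state. -/
theorem exists_bracket_eq (h : EvenEnds D P) :
    ∃ k : ℤ, bracket 5⁻¹ D P = 5 ^ (-(D.numCrossings + 2 * D.circlesA P : ℤ)) * k := by
  induction D generalizing P with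
  | nil =>
    refine ⟨(-626) ^ numClasses P, ?_⟩
    simp only [bracket, numCrossings, circlesA, List.flatMap_nil, List.length_nil, List.nil_append]
    -- A circle has the value `-626 / 25`.
    rw [show (-(((0 : ℕ) : ℤ) + 2 * (numClasses P : ℤ))) = -2 * (numClasses P : ℤ) by
      push_cast; ring, zpow_mul, zpow_natCast]
    push_cast
    rw [← mul_pow]
    norm_num
  | cons T D ih =>
    cases T with
    | point a b =>
      rw [circlesA_point, numCrossings_point]
      exact ih h.point
    | crossing a b c d =>
      obtain ⟨k, hk⟩ := ih h.smoothA
      obtain ⟨l, hl⟩ := ih h.smoothB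
      have tA := numClasses_smoothings fun S hS => h.smoothA.component (perm_ends_smoothA D) hS
      rw [← circlesA_cons_cons, ← circlesA_cons_cons] at tA
      obtain ⟨e, he⟩ := Nat.exists_eq_add_of_le (show circlesA D ((b, c) :: (d, a) :: P) ≤
        circlesA D ((a, b) :: (c, d) :: P) + 1 by omega)
      refine ⟨k + 5 ^ (2 * e) * l, ?_⟩
      simp only [bracket]
      rw [hk, hl, numCrossings_crossing, circlesA_crossing]
      have he' : (circlesA D ((b, c) :: (d, a) :: P) : ℤ) =
        circlesA D ((a, b) :: (c, d) :: P) + 1 - e := by omega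
      rw [he']
      generalize (circlesA D ((a, b) :: (c, d) :: P) : ℤ) = s
      have h1 : (5 : ℚ) ^ (-((numCrossings D : ℤ) + 2 * s)) =
          5 * 5 ^ (-(((numCrossings D + 1 : ℕ) : ℤ) + 2 * s)) := by
        rw [← zpow_one_add₀ (by norm_num)]
        congr 1
        push_cast
        ring
      have h2 : (5 : ℚ) ^ (-((numCrossings D : ℤ) + 2 * (s + 1 - e))) =
          5⁻¹ * 5 ^ (2 * e) * 5 ^ (-(((numCrossings D + 1 : ℕ) : ℤ) + 2 * s)) := by
        rw [← zpow_natCast, ← zpow_neg_one, ← zpow_add₀ (by norm_num), ← zpow_add₀ (by norm_num)]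
        congr 1
        push_cast
        ring
      rw [h1, h2]
      push_cast
      ring

/-- If no crossing joins a circle of the all-A state to itself, then the all-A state alone
contributes to the highest power of `A`. -/
theorem exists_bracket_eq_of_adequate (h : EvenEnds D P)
    (hA : ∀ a b c d, .crossing a b c d ∈ D → ¬ Conn (D.flatMap Tile.smoothA ++ P) b c) :
    ∃ k : ℤ, 5 ∣ k ^ 2 - 1 ∧
      bracket 5⁻¹ D P = 5 ^ (-(D.numCrossings + 2 * D.circlesA P : ℤ)) * k := by
  induction D generalizing P with
  | nil =>
    refine ⟨(-626) ^ numClasses P, ?_, ?_⟩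
    · rw [← pow_mul, mul_comm, pow_mul]
      have := sub_dvd_pow_sub_pow ((-626 : ℤ) ^ 2) 1 (numClasses P)
      rw [one_pow] at this
      exact (by norm_num : (5 : ℤ) ∣ (-626) ^ 2 - 1).trans this
    simp only [bracket, numCrossings, circlesA, List.flatMap_nil, List.length_nil, List.nil_append]
    -- A circle has the value `-626 / 25`.
    rw [show (-(((0 : ℕ) : ℤ) + 2 * (numClasses P : ℤ))) = -2 * (numClasses P : ℤ) by
      push_cast; ring, zpow_mul, zpow_natCast]
    push_cast
    rw [← mul_pow]
    norm_num
  | cons T D ih =>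
    have perm : ∀ L P : List (ℕ × ℕ), T.smoothA = L →
        (D.flatMap Tile.smoothA ++ (L ++ P)) ⊆ (T :: D).flatMap Tile.smoothA ++ P := by
      rintro L P rfl p hp
      simp only [List.mem_append, List.flatMap_cons] at hp ⊢
      tauto
    cases T with
    | point a b =>
      rw [circlesA_point, numCrossings_point]
      refine ih h.point fun x y z w hT hc => hA x y z w (List.mem_cons_of_mem _ hT) ?_
      exact hc.of_subset (perm [(a, b)] P rfl)
    | crossing a b c d =>
      obtain ⟨k, hk5, hk⟩ := ih h.smoothA fun x y z w hT hc =>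
        hA x y z w (List.mem_cons_of_mem _ hT) (hc.of_subset (perm [(a, b), (c, d)] P rfl))
      obtain ⟨l, hl⟩ := exists_bracket_eq h.smoothB
      have hbc : ¬ Conn ((a, b) :: (c, d) :: (D.flatMap Tile.smoothA ++ P)) b c :=
        hA a b c d (List.mem_cons_self ..)
      have tA := numClasses_smoothings fun S hS => h.smoothA.component (perm_ends_smoothA D) hS
      rw [← circlesA_cons_cons, ← circlesA_cons_cons] at tA
      have he : (circlesA D ((b, c) :: (d, a) :: P) : ℤ) =
        circlesA D ((a, b) :: (c, d) :: P) - 1 := by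
        rcases tA with t | t | t
        · exact absurd t.1 hbc
        · omega
        · exact absurd t.1 hbc
      refine ⟨k + 625 * l, ?_, ?_⟩
      · obtain ⟨u, hu⟩ := hk5
        exact ⟨u + 250 * k * l + 78125 * l ^ 2, by linear_combination hu⟩
      simp only [bracket]
      rw [hk, hl, numCrossings_crossing, circlesA_crossing, he]
      generalize (circlesA D ((a, b) :: (c, d) :: P) : ℤ) = s
      have h1 : (5 : ℚ) ^ (-((numCrossings D : ℤ) + 2 * s)) =
          5 * 5 ^ (-(((numCrossings D + 1 : ℕ) : ℤ) + 2 * s)) := by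
        rw [← zpow_one_add₀ (by norm_num)]
        congr 1
        push_cast
        ring
      have h2 : (5 : ℚ) ^ (-((numCrossings D : ℤ) + 2 * (s - 1))) =
          5 ^ 3 * 5 ^ (-(((numCrossings D + 1 : ℕ) : ℤ) + 2 * s)) := by
        rw [← zpow_natCast, ← zpow_add₀ (by norm_num)]
        congr 1
        push_cast
        ring
      rw [h1, h2]
      push_cast
      ring

/-- If the Turaev genus is zero, then the highest coefficient of the bracket is `±1`.  A crossing that
joins a circle of the all-A state to itself is nugatory, since otherwise its B-smoothing would
violate `circlesA_add_circlesB_le`.  Such crossings are removed one after the other, until the all-A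
state is adequate. -/
theorem unitLead_of_genus_zero (h : EvenEnds D P)
    (hg : D.circlesA P + D.circlesB P = D.numCrossings + 2 * D.numParts P) :
    UnitLead (bracket 5⁻¹ D P) := by
  induction hn : D.length using Nat.strong_induction_on generalizing D P with
  | _ n ih =>
  by_cases hA : ∀ a b c d, .crossing a b c d ∈ D → ¬ Conn (D.flatMap Tile.smoothA ++ P) b c
  · obtain ⟨k, hk, e⟩ := exists_bracket_eq_of_adequate h hA
    exact ⟨_, k, hk, e⟩
  push Not at hA
  obtain ⟨a, b, c, d, hT, hbc⟩ := hA
  obtain ⟨L, L', rfl⟩ := List.append_of_mem hT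
  have hp : (L ++ .crossing a b c d :: L').Perm (.crossing a b c d :: (L ++ L')) :=
    List.perm_middle
  replace hbc : Conn ((a, b) :: (c, d) :: ((L ++ L').flatMap Tile.smoothA ++ P)) b c :=
    hbc.of_subset ((hp.flatMap_right Tile.smoothA).append_right P).subset
  have h' := h.perm hp
  rw [circlesA_perm hp, circlesB_perm hp, numParts_perm hp, numCrossings_perm hp,
    numCrossings_crossing, circlesA_crossing, circlesB_crossing] at hg
  rw [bracket_perm hp]
  replace hn : (L ++ L').length < n := by
    rw [← hn]
    simp
  generalize L ++ L' = D at hg h' hn hbc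
  have tA := numClasses_smoothings fun S hS => h'.smoothA.component (perm_ends_smoothA D) hS
  have tB := numClasses_smoothings fun S hS => h'.smoothA.component (perm_ends_smoothB D) hS
  have tT := numClasses_smoothings fun S
    (hS : ∀ p ∈ D.flatMap (fun T => T.smoothA ++ T.smoothB) ++ P, S p.1 ↔ S p.2) =>
    h'.smoothA.component (perm_ends_smoothA D)
      (closed_of_closed (fun T => List.subset_append_left _ _) hS)
  have hle := circlesA_add_circlesB_le h'.smoothB
  rw [← circlesA_cons_cons, ← circlesA_cons_cons] at tA
  rw [← circlesB_cons_cons, ← circlesB_cons_cons] at tB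
  rw [← numParts_cons_cons, ← numParts_cons_cons] at tT
  change _ = _ + 2 * numClasses ((a, b) :: (c, d) :: (b, c) :: (d, a) ::
    (D.flatMap (fun T => T.smoothA ++ T.smoothB) ++ P)) at hg
  have hs : ¬ Conn ((b, c) :: (d, a) ::
      (D.flatMap (fun T => T.smoothA ++ T.smoothB) ++ P)) a b := by
    intro hs
    have e1 : numParts D ((b, c) :: (d, a) :: P) = numClasses ((a, b) :: (c, d) :: (b, c) ::
        (d, a) :: (D.flatMap (fun T => T.smoothA ++ T.smoothB) ++ P)) := by
      rcases tT with t | t | t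
      · exact t.2.2.2
      · exact t.2.2.2
      · exact absurd hs t.2.1
    have e2 : circlesA D ((a, b) :: (c, d) :: P) ≤ circlesA D ((b, c) :: (d, a) :: P) := by
      rcases tA with t | t | t
      · omega
      · exact absurd hbc t.1
      · omega
    omega
  have hsB : ¬ Conn ((b, c) :: (d, a) :: (D.flatMap Tile.smoothB ++ P)) a b := by
    refine fun h' => hs (h'.of_subset ?_)
    intro p hp
    simp only [List.mem_cons, List.mem_append, List.mem_flatMap] at hp ⊢
    rcases hp with hp | hp | ⟨T, hT, hp⟩ | hp
    · exact Or.inl hp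
    · exact Or.inr (Or.inl hp)
    · exact Or.inr (Or.inr (Or.inl ⟨T, hT, Or.inr hp⟩))
    · exact Or.inr (Or.inr (Or.inr hp))
  have key := ih _ hn h'.smoothA (by
    rcases tT with t | t | t
    · exact absurd t.2.1 hs
    · exact absurd t.2.1 hs
    rcases tB with t' | t' | t'
    · exact absurd t'.2.1 hsB
    · exact absurd t'.2.1 hsB
    omega) rfl
  simp only [bracket]
  rw [bracket_smoothB_of_split h'.smoothA hs]
  convert (unitLead_neg_zpow_mul 3).2 key using 1
  norm_num
  ring

end Code

/-! ### Minimality of the Turaev genus -/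

/-- Up to units, the bracket is an invariant of the knot, and `UnitLead` ignores the units. -/
theorem unitLead_bracket_iff_of_knot_eq {A : ℚ} (hA : A = 5 ∨ A = 5⁻¹) {D D' : KnotDiagram}
    (h : D.knot = D'.knot) :
    UnitLead (bracket A D.code []) ↔ UnitLead (bracket A D'.code []) := by
  have hA0 : A ≠ 0 := by rcases hA with rfl | rfl <;> norm_num
  have h' : Relation.EqvGen ReidemeisterStep D D' := Quot.eqvGen_exact h
  clear h
  induction h' with
  | rel D D' h =>
    rcases h with h | h | h | h
    · rw [bracket_sameDiagram D.two_ends h]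
    · have h3 : A ^ 3 = 5 ^ (3 : ℤ) ∧ A⁻¹ ^ 3 = 5 ^ (-3 : ℤ) ∨
          A ^ 3 = 5 ^ (-3 : ℤ) ∧ A⁻¹ ^ 3 = 5 ^ (3 : ℤ) := by
        rcases hA with rfl | rfl
        · left
          norm_num
        · right
          norm_num
      rcases bracket_reidemeisterI hA0 D.two_ends h with h | h <;>
        rcases h3 with ⟨h1, h2⟩ | ⟨h1, h2⟩ <;> simp only [h, h1, h2, unitLead_neg_zpow_mul]
    · rw [bracket_reidemeisterII hA0 D.two_ends h]
    · rw [bracket_reidemeisterIII hA0 D.two_ends h]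
  | refl D => rfl
  | symm D D' _ ih => exact ih.symm
  | trans D D' D'' _ _ ih ih' => exact ih.trans ih'

namespace Code

theorem circlesA_mirror (D : Code) : circlesA (D.map Tile.mirror) [] = circlesB D [] := by
  unfold circlesA circlesB
  rw [List.flatMap_map]
  congr 2
  refine List.flatMap_congr fun T _ => ?_
  cases T <;> rfl

theorem circlesB_mirror (D : Code) : circlesB (D.map Tile.mirror) [] = circlesA D [] := by
  refine numClasses_perm (List.Perm.append_right _ ?_)
  rw [List.flatMap_map]
  refine List.Perm.flatMap_left _ fun T _ => ?_
  cases T with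
  | point a b => exact .refl _
  | crossing a b c d => exact .swap ..

theorem numParts_mirror (D : Code) : numParts (D.map Tile.mirror) [] = numParts D [] := by
  refine numClasses_perm (List.Perm.append_right _ ?_)
  rw [List.flatMap_map]
  refine List.Perm.flatMap_left _ fun T _ => ?_
  cases T with
  | point a b => exact .refl _
  | crossing a b c d =>
    exact (List.perm_append_comm (l₁ := [(b, c), (d, a)]) (l₂ := [(c, d), (a, b)])).trans
      (.append_right _ (.swap ..))

theorem numCrossings_mirror (D : Code) : numCrossings (D.map Tile.mirror) = numCrossings D := by
  unfold numCrossings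
  rw [List.flatMap_map, List.length_flatMap, List.length_flatMap]
  congr 1
  refine List.map_congr_left fun T _ => ?_
  cases T <;> rfl

/-- The projection of a knot is connected. -/
theorem numParts_le_numClasses_strands (D : Code) :
    numParts D [] ≤ numClasses (D.flatMap Tile.strands) := by
  refine numClasses_le (fun x => ?_) fun p hp => ?_
  · simp only [List.append_nil, occurs_iff, List.flatMap_assoc, List.mem_flatMap (l := D)]
    refine exists_congr fun T => and_congr_right fun _ => ?_
    cases T <;> simp [Tile.strands, Tile.smoothA, Tile.smoothB] <;> tauto
  · obtain ⟨T, hT, hp⟩ := List.mem_flatMap.1 hp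
    rw [List.append_nil]
    have key : ∀ q ∈ T.smoothA ++ T.smoothB,
        Conn (D.flatMap fun T => T.smoothA ++ T.smoothB) q.1 q.2 :=
      fun q hq => .of_mem (List.mem_flatMap.2 ⟨T, hT, hq⟩)
    cases T with
    | point a b => exact key p (List.mem_append_left _ hp)
    | crossing a b c d =>
      have hab := key (a, b) (by simp [Tile.smoothA])
      have hbc := key (b, c) (by simp [Tile.smoothB])
      have hcd := key (c, d) (by simp [Tile.smoothA])
      simp only [Tile.strands, List.mem_cons, List.not_mem_nil, or_false] at hp
      rcases hp with rfl | rfl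
      · exact hab.trans hbc
      · exact hbc.trans hcd

end Code

namespace KnotDiagram

variable {A : ℚ} {D : KnotDiagram}

theorem unitLead_bracket_of_hasTuraevGenus_zero (hA : A = 5 ∨ A = 5⁻¹) (hD : D.HasTuraevGenus 0) :
    UnitLead (bracket A D.code []) := by
  have hE := TwoEnds.evenEnds D.two_ends
  have hg : D.code.circlesA [] + D.code.circlesB [] =
      D.code.numCrossings + 2 * D.code.numParts [] := by
    have h1 := Code.circlesA_add_circlesB_le hE
    have h2 := D.code.numParts_le_numClasses_strands
    rw [D.one_component] at h2
    have h3 : (D.code.circlesA [] : ℤ) - D.code.numCrossings + D.code.circlesB [] = 2 := by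
      unfold HasTuraevGenus numCirclesA numCirclesB at hD
      simpa [Code.circlesA, Code.circlesB] using hD
    omega
  rcases hA with rfl | rfl
  · -- At `A = 5` the mirror image is considered.
    have := Code.unitLead_of_genus_zero (TwoEnds.evenEnds (TwoEnds.mirror D.two_ends)) (P := []) (by
      rw [Code.circlesA_mirror, Code.circlesB_mirror, Code.numParts_mirror,
        Code.numCrossings_mirror, add_comm]
      exact hg)
    rwa [bracket_mirror, inv_inv] at this
  · exact Code.unitLead_of_genus_zero hE hg

theorem hasMinimalTuraevGenus_of_not_unitLead (hA : A = 5 ∨ A = 5⁻¹) (hD : D.HasTuraevGenus 1)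
    (h : ¬ UnitLead (bracket A D.code [])) : D.HasMinimalTuraevGenus := by
  have : D.knot.turaevGenus = 1 := by
    refine le_antisymm (Nat.sInf_le ⟨D, rfl, hD⟩) (Nat.one_le_iff_ne_zero.2 fun h0 => ?_)
    obtain ⟨D', hD', h'⟩ := Nat.sInf_mem (s := {g | ∃ D' : KnotDiagram, D'.knot = D.knot ∧
      D'.HasTuraevGenus g}) ⟨1, D, rfl, hD⟩
    rw [show sInf {g | ∃ D' : KnotDiagram, D'.knot = D.knot ∧ D'.HasTuraevGenus g} = 0
      from h0] at h'
    exact h ((unitLead_bracket_iff_of_knot_eq hA hD').1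
      (unitLead_bracket_of_hasTuraevGenus_zero hA h'))
  unfold HasMinimalTuraevGenus
  rwa [this]

end KnotDiagram

/-! ### Recognizing knot diagrams -/

namespace Code

/-- The slots of the vertices of `D`, if the vertices are numbered from `n` on: the number of a slot
and of the next slot at the same vertex, and the arcs that end there. -/
def slotData : ℕ → Code → List ((ℕ × ℕ) × ℕ × ℕ)
  | _, [] => []
  | n, T :: D => (List.range T.ends.length).map (fun j =>
      ((4 * n + j, 4 * n + (j + 1) % T.ends.length),
        T.ends.getD j 0, T.ends.getD ((j + 1) % T.ends.length) 0)) ++ slotData (n + 1) D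

/-- The pairs of successive corners of the faces. -/
def facePairs (D : Code) : List (ℕ × ℕ) :=
  (slotData 0 D).flatMap fun s => ((slotData 0 D).filter fun t =>
    s.1.2 != t.1.1 && s.2.2 == t.2.1).map fun t => (s.1.1, t.1.1)

variable {D : Code}

/-- The number of a slot in `slotData`. -/
def Slot.number (s : D.Slot) : ℕ := 4 * s.1 + s.2

theorem length_ends_le (T : Tile) : T.ends.length ≤ 4 := by
  cases T <;> simp [Tile.ends]

theorem Slot.number_injective : Function.Injective (Slot.number (D := D)) := by
  rintro ⟨i, j⟩ ⟨i', j'⟩ h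
  have hj := j.2.trans_le (length_ends_le _)
  have hj' := j'.2.trans_le (length_ends_le _)
  simp only [Slot.number] at h
  obtain rfl : i = i' := Fin.ext (by omega)
  obtain rfl : j = j' := Fin.ext (by omega)
  rfl

theorem mem_slotData {n : ℕ} {q : (ℕ × ℕ) × ℕ × ℕ} : q ∈ slotData n D ↔
    ∃ s : D.Slot, q = ((4 * n + s.number, 4 * n + s.succ.number), s.arc, s.succ.arc) := by
  induction D generalizing n with
  | nil =>
    simp only [slotData, List.not_mem_nil, false_iff]
    rintro ⟨⟨i, _⟩, _⟩
    exact i.elim0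
  | cons T D ih =>
    simp only [slotData, List.mem_append, List.mem_map, List.mem_range, ih]
    constructor
    · rintro (⟨j, hj, rfl⟩ | ⟨⟨i, j⟩, rfl⟩)
      · have hj' : (j + 1) % T.ends.length < T.ends.length := Nat.mod_lt _ (Nat.zero_lt_of_lt hj)
        refine ⟨⟨⟨0, by simp⟩, ⟨j, hj⟩⟩, ?_⟩
        simp only [Slot.number, Slot.succ, Slot.arc, Prod.mk.injEq]
        refine ⟨⟨by simp, by simp⟩, ?_, ?_⟩
        · exact List.getD_eq_getElem _ _ hj
        · exact List.getD_eq_getElem _ _ hj'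
      · refine ⟨⟨i.succ, j⟩, ?_⟩
        simp only [Slot.number, Slot.succ, Slot.arc, Prod.mk.injEq, Fin.val_succ]
        refine ⟨⟨by omega, ?_⟩, rfl, rfl⟩
        change _ = 4 * n + (4 * (i.1 + 1) + (j.1 + 1) % (D.get i).ends.length)
        omega
    · rintro ⟨⟨⟨i, hi⟩, j⟩, rfl⟩
      cases i with
      | zero =>
        left
        have hj : j.1 < T.ends.length := j.2
        have hj' : (j.1 + 1) % T.ends.length < T.ends.length :=
          Nat.mod_lt _ (Nat.zero_lt_of_lt hj)
        refine ⟨j.1, hj, ?_⟩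
        simp only [Slot.number, Slot.succ, Slot.arc, Prod.mk.injEq]
        refine ⟨⟨by simp, by simp⟩, ?_, ?_⟩
        · exact List.getD_eq_getElem _ _ hj
        · exact List.getD_eq_getElem _ _ hj'
      | succ i =>
        right
        refine ⟨⟨⟨i, by simpa using hi⟩, j⟩, ?_⟩
        simp only [Slot.number, Slot.succ, Slot.arc, Prod.mk.injEq]
        refine ⟨⟨by omega, ?_⟩, rfl, rfl⟩
        change _ = 4 * (n + 1) + (4 * i + (j.1 + 1) % (D.get ⟨i, by simpa using hi⟩).ends.length)
        change 4 * n + (4 * (i + 1) + (j.1 + 1) % (D.get ⟨i, by simpa using hi⟩).ends.length) = _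
        omega

theorem mem_facePairs {x y : ℕ} : (x, y) ∈ D.facePairs ↔
    ∃ s t : D.Slot, (s.succ ≠ t ∧ s.succ.arc = t.arc) ∧ s.number = x ∧ t.number = y := by
  simp only [facePairs, List.mem_flatMap, List.mem_map, List.mem_filter, mem_slotData]
  constructor
  · rintro ⟨_, ⟨s, rfl⟩, _, ⟨⟨t, rfl⟩, h⟩, he⟩
    simp only [mul_zero, zero_add, Prod.mk.injEq, Bool.and_eq_true, bne_iff_ne, ne_eq,
      beq_iff_eq] at h he
    exact ⟨s, t, ⟨fun e => h.1 (congrArg _ e), h.2⟩, he⟩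
  · rintro ⟨s, t, ⟨h1, h2⟩, rfl, rfl⟩
    refine ⟨_, ⟨s, rfl⟩, _, ⟨⟨t, rfl⟩, ?_⟩, by simp⟩
    simp only [mul_zero, zero_add, Bool.and_eq_true, bne_iff_ne, ne_eq, beq_iff_eq]
    exact ⟨fun e => h1 (Slot.number_injective e), h2⟩

/-- Under the hypothesis, every corner has a successor, so that no corner is missing in the pairs. -/
theorem numFaces_eq (h : ∀ q ∈ slotData 0 D, ∃ p ∈ D.facePairs, q.1.1 = p.1) :
    D.numFaces = numClasses D.facePairs := by
  have h1 : ∀ s : D.Slot, Occurs D.facePairs s.number := by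
    intro s
    obtain ⟨p, hp, e⟩ := h _ (mem_slotData.2 ⟨s, rfl⟩)
    exact ⟨p, hp, Or.inl (by simpa using e)⟩
  have h2 : ∀ x, Occurs D.facePairs x → ∃ s : D.Slot, s.number = x := by
    rintro x ⟨⟨y, z⟩, hp, hx⟩
    obtain ⟨s, t, -, rfl, rfl⟩ := mem_facePairs.1 hp
    rcases hx with rfl | rfl
    · exact ⟨s, rfl⟩
    · exact ⟨t, rfl⟩
  let e : D.Slot ≃ {a : ℕ // Occurs D.facePairs a} :=
    Equiv.ofBijective (fun s => ⟨s.number, h1 s⟩)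
      ⟨fun s t hst => Slot.number_injective (congrArg Subtype.val hst), fun x => by
        obtain ⟨s, hs⟩ := h2 x.1 x.2
        exact ⟨s, Subtype.ext hs⟩⟩
  refine Nat.card_congr (Quot.congr e fun s t => ?_)
  change _ ↔ (s.number, t.number) ∈ D.facePairs
  rw [mem_facePairs]
  constructor
  · exact fun h => ⟨s, t, h, rfl, rfl⟩
  · rintro ⟨s', t', h, hs, ht⟩
    obtain rfl := Slot.number_injective hs
    obtain rfl := Slot.number_injective ht
    exact h

/-- An algorithm that recognizes the codes of knot diagrams. -/
def isKnotDiagram (D : Code) : Bool :=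
  D.arcEnds.all (fun x => D.arcEnds.count x == 2) &&
  countClasses (D.flatMap Tile.strands).length (D.flatMap Tile.strands) == 1 &&
  (slotData 0 D).all (fun q => D.facePairs.any fun p => q.1.1 == p.1) &&
  countClasses D.facePairs.length D.facePairs == D.numCrossings + 2

end Code

/-- The knot diagram with a given code. -/
def KnotDiagram.ofCode (D : Code) (h : D.isKnotDiagram = true) : KnotDiagram where
  code := D
  two_ends := by
    simp only [Code.isKnotDiagram, Bool.and_eq_true, List.all_eq_true, beq_iff_eq] at h
    exact h.1.1.1
  one_component := by
    simp only [Code.isKnotDiagram, Bool.and_eq_true, beq_iff_eq] at h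
    rw [numClasses_eq_countClasses, h.1.1.2]
  planar := by
    simp only [Code.isKnotDiagram, Bool.and_eq_true, List.all_eq_true, List.any_eq_true,
      beq_iff_eq] at h
    rw [Code.numFaces_eq h.1.2, numClasses_eq_countClasses, h.2]

/-! ### Sequences of moves -/

instance : DecidableEq Tile := fun T T' =>
  decidable_of_iff (T.ends = T'.ends) ⟨fun h => by cases T <;> cases T' <;> simp_all [Tile.ends],
    fun h => congrArg _ h⟩

/-- Some moves between codes; those that change the diagram apply to the vertices at the beginning
of the list. -/
inductive Move where
  /-- The vertex with the given index is put at the beginning. -/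
  | front (i : ℕ)
  /-- The ends at the first vertex are listed from the opposite end on. -/
  | turn
  /-- The arcs are renamed by the product of transpositions. -/
  | rename (l : List (ℕ × ℕ))
  /-- A marked point divides the arc `a` into `a` and `b`, and `T` replaces the first vertex. -/
  | split (a b : ℕ) (T : Tile)
  /-- The first vertex, a marked point, is erased. -/
  | join
  /-- The first vertex, a marked point, is replaced by a kink with the loop `b`. -/
  | kink (b : ℕ)
  /-- The first vertex, a kink, is replaced by a marked point. -/
  | unkink
  /-- A Reidemeister III move on the first three vertices. -/
  | slide

namespace Move

open Tile

/-- The result of a move; where it is not possible, the code is left unchanged. -/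
def apply : Move → Code → Code
  | front i, D =>
    match D.drop i with
    | T :: L => T :: (D.take i ++ L)
    | [] => D
  | turn, point a b :: L => point b a :: L
  | turn, crossing a b c d :: L => crossing c d a b :: L
  | rename l, D => D.map (Tile.map (l.map fun p => Equiv.swap p.1 p.2).prod)
  | split a b T, D =>
    if a ≠ b ∧ (T :: D.tail).map (Tile.map fun x => if x = b then a else x) = D then
      point a b :: T :: D.tail
    else D
  | join, point a b :: L =>
    if a = b then point a b :: L else L.map (Tile.map fun x => if x = b then a else x)
  | kink b, point a c :: L => crossing a b b c :: L
  | unkink, crossing a b b' c :: L => if b' = b then point a c :: L else crossing a b b' c :: L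
  | slide, crossing p₁ p₂ i₁ i₂ :: crossing p₄ i₃ j₁ p₃ :: crossing p₅ p₆ j₂ j₃ :: L =>
    if j₁ = i₁ ∧ j₂ = i₂ ∧ j₃ = i₃ then
      crossing p₂ p₃ i₂ i₃ :: crossing p₄ p₅ i₁ i₂ :: crossing p₁ i₃ i₁ p₆ :: L
    else crossing p₁ p₂ i₁ i₂ :: crossing p₄ i₃ j₁ p₃ :: crossing p₅ p₆ j₂ j₃ :: L
  | _, D => D

/-- The codes that occur in a sequence of moves after the first one. -/
def trace : List Move → Code → List Code
  | [], _ => []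
  | m :: l, D => m.apply D :: trace l (m.apply D)

theorem apply_spec (m : Move) (D : Code) : D = m.apply D ∨
    (SameDiagram D (m.apply D) ∨ ReidemeisterI D (m.apply D) ∨ ReidemeisterII D (m.apply D) ∨
      ReidemeisterIII D (m.apply D)) ∨
    (SameDiagram (m.apply D) D ∨ ReidemeisterI (m.apply D) D ∨ ReidemeisterII (m.apply D) D ∨
      ReidemeisterIII (m.apply D) D) := by
  unfold apply
  split
  · split
    · rename_i i _ T L h
      refine Or.inr (Or.inl (Or.inl (.perm ?_)))
      conv_lhs => rw [← List.take_append_drop i D, h]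
      exact List.perm_middle
    · exact Or.inl rfl
  · exact Or.inr (Or.inl (Or.inl (.rotatePoint ..)))
  · exact Or.inr (Or.inl (Or.inl (.rotateCrossing ..)))
  · exact Or.inr (Or.inl (Or.inl (.rename ..)))
  · split_ifs with h
    · refine Or.inr (Or.inr (Or.inl ?_))
      conv_rhs => rw [← h.2]
      exact .erase _ _ _ h.1
    · exact Or.inl rfl
  · split_ifs with h
    · exact Or.inl rfl
    · exact Or.inr (Or.inl (Or.inl (.erase _ _ _ h)))
  · exact Or.inr (Or.inr (Or.inr (Or.inl (.kink' ..))))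
  · split_ifs with h
    · subst h
      exact Or.inr (Or.inl (Or.inr (Or.inl (.kink' ..))))
    · exact Or.inl rfl
  · split_ifs with h
    · obtain ⟨rfl, rfl, rfl⟩ := h
      exact Or.inr (Or.inl (Or.inr (Or.inr (Or.inr (.up ..)))))
    · exact Or.inl rfl
  · exact Or.inl rfl

/-- A sequence of moves does not change the knot, provided that all intermediate codes are codes of
knot diagrams. -/
theorem knot_eq_of_trace (l : List Move) {D D' : KnotDiagram}
    (h : ∀ C ∈ trace l D.code, C.isKnotDiagram = true)
    (h' : (trace l D.code).getLastD D.code = D'.code) : D.knot = D'.knot := by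
  induction l generalizing D with
  | nil =>
    obtain ⟨C, _⟩ := D
    obtain ⟨C', _⟩ := D'
    obtain rfl : C = C' := h'
    rfl
  | cons m l ih =>
    simp only [trace, List.mem_cons, forall_eq_or_imp, List.getLastD_cons] at h h'
    refine Eq.trans ?_ (ih (D := .ofCode _ h.1) h.2 h')
    rcases m.apply_spec D.code with e | e | e
    · obtain ⟨C, _⟩ := D
      unfold KnotDiagram.ofCode
      congr 1
      simp only at e
      congr
    · exact Quot.sound e
    · exact (Quot.sound (show ReidemeisterStep (.ofCode _ h.1) D from e)).symm

end Move

/-! ### The diagrams of `8_21` -/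

namespace EightTwentyOne

/-- Moves from `knotAtlasMoved` to `knotScapeMirror`: a kink is added, three Reidemeister III moves are
made, a kink is removed, and the code is brought into the required form. -/
def movesToKnotScapeMirror : List Move :=
  [.front 7, .split 12 17 (.crossing 7 17 8 13), .kink 18,
   .front 1, .turn, .front 1, .turn, .front 8, .turn, .slide,
   .front 5, .turn, .front 2, .front 3, .slide,
   .front 5, .turn, .front 3, .turn, .front 8, .slide,
   .front 2, .turn, .unkink, .join,
   .front 2, .turn, .front 3, .front 2, .turn, .front 4, .turn, .front 6, .front 5, .turn,
   .front 7, .turn, .front 7,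
   .rename [(1, 4), (4, 7), (7, 10), (10, 18), (18, 14), (2, 5), (5, 8), (8, 11), (11, 12),
    (12, 13), (13, 16), (16, 3), (3, 6), (6, 9), (9, 17), (17, 15)]]

theorem isKnotDiagram_knotAtlas : knotAtlas.isKnotDiagram = true := by decide +kernel

theorem isKnotDiagram_trace :
    ∀ C ∈ Move.trace movesToKnotScapeMirror knotAtlasMoved, C.isKnotDiagram = true := by
  decide +kernel

theorem getLastD_trace :
    (Move.trace movesToKnotScapeMirror knotAtlasMoved).getLastD knotAtlasMoved =
      knotScapeMirror := by
  decide +kernel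

end EightTwentyOne

/-! ### Computing the quasi-tree polynomial -/

namespace RibbonGraph

/-- The number of quasi-trees of genus `j` of a ribbon graph with `v` vertices, in a form that can be
evaluated. -/
def countQuasiTrees (G : RibbonGraph) (v j : ℕ) : ℕ :=
  (Finset.univ.filter fun S : Finset (Fin G.bands.length) =>
    (v : ℤ) - (S.card : ℤ) + 1 = 2 - 2 * (j : ℤ) ∧
      countClasses (G.boundary S).length (G.boundary S) = 1).card

theorem numQuasiTrees_eq (G : RibbonGraph) (j : ℕ) :
    G.numQuasiTrees j =
      G.countQuasiTrees (countClasses (G.boundary ∅).length (G.boundary ∅)) j := by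
  unfold numQuasiTrees countQuasiTrees
  classical
  rw [Nat.card_eq_fintype_card, Fintype.card_subtype]
  congr 1
  refine Finset.filter_congr fun S _ => ?_
  rw [IsQuasiTreeOfGenus, IsQuasiTree, numVertices, numBoundary, numBoundary,
    numClasses_eq_countClasses, numClasses_eq_countClasses, and_comm]

theorem quasiTreePolynomial_eq_of_count {G : RibbonGraph} {v a b : ℕ}
    (hv : countClasses (G.boundary ∅).length (G.boundary ∅) = v)
    (hG : 0 < G.bands.length)
    (h : ∀ j ∈ Finset.range (G.bands.length + 1),
      G.countQuasiTrees v j = if j = 0 then a else if j = 1 then b else 0) :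
    G.quasiTreePolynomial = (b : ℤ[X]) * X + (a : ℤ[X]) := by
  have key : G.quasiTreePolynomial = ∑ j ∈ Finset.range (G.bands.length + 1),
      ((if j = 0 then (a : ℤ[X]) else 0) + if j = 1 then (b : ℤ[X]) * X else 0) := by
    refine Finset.sum_congr rfl fun j hj => ?_
    rw [numQuasiTrees_eq, hv, h j hj]
    rcases j with _ | _ | j
    · simp
    · simp [← C_mul_X_pow_eq_monomial]
    · simp
  rw [key, Finset.sum_add_distrib, Finset.sum_ite_eq', Finset.sum_ite_eq', if_pos (by simp),
    if_pos (by simpa using hG), add_comm]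

end RibbonGraph

namespace EightTwentyOne

theorem isKnotDiagram_knotAtlasMoved : knotAtlasMoved.isKnotDiagram = true := by decide +kernel

theorem isKnotDiagram_knotScape : knotScape.isKnotDiagram = true := by decide +kernel

theorem isKnotDiagram_knotScapeMirror : knotScapeMirror.isKnotDiagram = true := by decide +kernel

theorem quasiTreePolynomial_knotAtlasMoved :
    (KnotDiagram.ofCode _ isKnotDiagram_knotAtlasMoved).allA.quasiTreePolynomial =
      6 * X + 21 :=
  RibbonGraph.quasiTreePolynomial_eq_of_count (v := 5) (a := 21) (b := 6)
    (by decide +kernel) (by decide +kernel) (by decide +kernel)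

theorem quasiTreePolynomial_knotScape :
    (KnotDiagram.ofCode _ isKnotDiagram_knotScape).allA.quasiTreePolynomial =
      24 * X + 9 :=
  RibbonGraph.quasiTreePolynomial_eq_of_count (v := 3) (a := 9) (b := 24)
    (by decide +kernel) (by decide +kernel) (by decide +kernel)

theorem quasiTreePolynomial_knotScapeMirror :
    (KnotDiagram.ofCode _ isKnotDiagram_knotScapeMirror).allA.quasiTreePolynomial =
      9 * X + 24 :=
  RibbonGraph.quasiTreePolynomial_eq_of_count (v := 5) (a := 24) (b := 9)
    (by decide +kernel) (by decide +kernel) (by decide +kernel)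

end EightTwentyOne

/-! ### Computing the bracket -/

theorem UnitLead.dvd {e w : ℤ} (h : UnitLead (5 ^ e * w)) (hw : ¬ 5 ∣ w) : 5 ∣ w ^ 2 - 1 := by
  obtain ⟨m, k, hk, h⟩ := h
  have h5 : (5 : ℚ) ≠ 0 := by norm_num
  rcases le_total e m with hle | hle
  · obtain ⟨n, rfl⟩ := Int.le.dest hle
    rw [zpow_add₀ h5, mul_assoc, mul_right_inj' (zpow_ne_zero _ h5), zpow_natCast] at h
    have h' : w = 5 ^ n * k := by exact_mod_cast h
    rcases n with _ | n
    · simpa [h'] using hk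
    · exact absurd ⟨5 ^ n * k, by rw [h']; ring⟩ hw
  · obtain ⟨n, rfl⟩ := Int.le.dest hle
    rw [zpow_add₀ h5, mul_assoc, mul_right_inj' (zpow_ne_zero _ h5), zpow_natCast] at h
    have h' : 5 ^ n * w = k := by exact_mod_cast h
    rcases n with _ | n
    · simpa [← h'] using hk
    · have : (5 : ℤ) ∣ k ^ 2 := ⟨5 ^ n * w * k, by rw [← h']; ring⟩
      have := (dvd_sub_right this).1 hk
      norm_num at this

/-- The bracket, in a form that can be evaluated. -/
def evalBracket (A : ℚ) : Code → List (ℕ × ℕ) → ℚ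
  | [], P => (-A ^ 2 - A⁻¹ ^ 2) ^ countClasses P.length P
  | .point a b :: D, P => evalBracket A D ((a, b) :: P)
  | .crossing a b c d :: D, P =>
    A * evalBracket A D ((a, b) :: (c, d) :: P) + A⁻¹ * evalBracket A D ((b, c) :: (d, a) :: P)

theorem bracket_eq_evalBracket (A : ℚ) (D : Code) (P : List (ℕ × ℕ)) :
    bracket A D P = evalBracket A D P := by
  induction D generalizing P with
  | nil => rw [bracket, evalBracket, numClasses_eq_countClasses]
  | cons T D ih => cases T <;> simp only [bracket, evalBracket, ih]

theorem KnotDiagram.hasTuraevGenus_of_count {D : KnotDiagram} {g : ℕ}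
    (h : (countClasses (D.code.flatMap Tile.smoothA).length (D.code.flatMap Tile.smoothA) : ℤ) -
      (D.code.numCrossings : ℤ) +
      (countClasses (D.code.flatMap Tile.smoothB).length (D.code.flatMap Tile.smoothB) : ℤ) =
        2 - 2 * (g : ℤ)) : D.HasTuraevGenus g := by
  rw [HasTuraevGenus, numCirclesA, numCirclesB, numClasses_eq_countClasses,
    numClasses_eq_countClasses]
  exact h

namespace EightTwentyOne

/-- The lowest coefficient of the bracket is `-2`. -/
theorem not_unitLead_knotScapeMirror : ¬ UnitLead (bracket 5 knotScapeMirror []) := by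
  have h : evalBracket 5 knotScapeMirror [] = -37193298187256250002 / 9765625 := by decide +kernel
  have h' : bracket 5 knotScapeMirror [] = 5 ^ (-10 : ℤ) * (-37193298187256250002 : ℤ) := by
    rw [bracket_eq_evalBracket, h]
    norm_num
  rw [h']
  exact fun hu => absurd (hu.dvd (by decide)) (by decide)

theorem not_unitLead_knotScape : ¬ UnitLead (bracket 5⁻¹ knotScape []) := by
  rw [← bracket_mirror]
  exact not_unitLead_knotScapeMirror

end EightTwentyOne

theorem theorem1p1 :
    (¬ ∃ f : Knot → ℤ[X], ∀ D : KnotDiagram, D.HasMinimalTuraevGenus →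
      D.allA.quasiTreePolynomial = f D.knot) ∧
    ∃ D₀ D₁ D₂ D₃ : KnotDiagram,
      D₀.code = EightTwentyOne.knotAtlas ∧ D₁.code = EightTwentyOne.knotAtlasMoved ∧
      D₂.code = EightTwentyOne.knotScape ∧ D₃.code = EightTwentyOne.knotScapeMirror ∧
      ReidemeisterIII D₀.code D₁.code ∧ D₁.knot = D₀.knot ∧ D₃.knot = D₀.knot ∧
      D₀.HasTuraevGenus 2 ∧
      D₁.HasTuraevGenus 1 ∧ D₁.HasMinimalTuraevGenus ∧
      D₂.HasTuraevGenus 1 ∧ D₂.HasMinimalTuraevGenus ∧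
      D₃.HasTuraevGenus 1 ∧ D₃.HasMinimalTuraevGenus ∧
      D₁.allA.quasiTreePolynomial = 6 * X + 21 ∧
      D₂.allA.quasiTreePolynomial = 24 * X + 9 ∧
      D₃.allA.quasiTreePolynomial = 9 * X + 24 := by
  let D₀ := KnotDiagram.ofCode _ EightTwentyOne.isKnotDiagram_knotAtlas
  let D₁ := KnotDiagram.ofCode _ EightTwentyOne.isKnotDiagram_knotAtlasMoved
  let D₂ := KnotDiagram.ofCode _ EightTwentyOne.isKnotDiagram_knotScape
  let D₃ := KnotDiagram.ofCode _ EightTwentyOne.isKnotDiagram_knotScapeMirror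
  have h01 : ReidemeisterIII D₀.code D₁.code := .down ..
  have k01 : D₁.knot = D₀.knot :=
    (Quot.sound (show ReidemeisterStep D₀ D₁ from Or.inr (Or.inr (Or.inr h01)))).symm
  have k13 : D₁.knot = D₃.knot :=
    Move.knot_eq_of_trace _ EightTwentyOne.isKnotDiagram_trace EightTwentyOne.getLastD_trace
  have g0 : D₀.HasTuraevGenus 2 := KnotDiagram.hasTuraevGenus_of_count (by decide +kernel)
  have g1 : D₁.HasTuraevGenus 1 := KnotDiagram.hasTuraevGenus_of_count (by decide +kernel)
  have g2 : D₂.HasTuraevGenus 1 := KnotDiagram.hasTuraevGenus_of_count (by decide +kernel)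
  have g3 : D₃.HasTuraevGenus 1 := KnotDiagram.hasTuraevGenus_of_count (by decide +kernel)
  have m1 : D₁.HasMinimalTuraevGenus :=
    KnotDiagram.hasMinimalTuraevGenus_of_not_unitLead (Or.inl rfl) g1 fun h =>
      EightTwentyOne.not_unitLead_knotScapeMirror
        ((unitLead_bracket_iff_of_knot_eq (Or.inl rfl) k13).1 h)
  have m2 : D₂.HasMinimalTuraevGenus :=
    KnotDiagram.hasMinimalTuraevGenus_of_not_unitLead (Or.inr rfl) g2
      EightTwentyOne.not_unitLead_knotScape
  have m3 : D₃.HasMinimalTuraevGenus :=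
    KnotDiagram.hasMinimalTuraevGenus_of_not_unitLead (Or.inl rfl) g3
      EightTwentyOne.not_unitLead_knotScapeMirror
  refine ⟨?_, D₀, D₁, D₂, D₃, rfl, rfl, rfl, rfl, h01, k01, k13.symm.trans k01, g0, g1, m1, g2, m2,
    g3, m3, EightTwentyOne.quasiTreePolynomial_knotAtlasMoved,
    EightTwentyOne.quasiTreePolynomial_knotScape,
    EightTwentyOne.quasiTreePolynomial_knotScapeMirror⟩
  rintro ⟨f, hf⟩
  have h : (6 * X + 21 : ℤ[X]) = 9 * X + 24 := by
    rw [← EightTwentyOne.quasiTreePolynomial_knotAtlasMoved,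
      ← EightTwentyOne.quasiTreePolynomial_knotScapeMirror]
    exact (hf D₁ m1).trans ((congrArg f k13).trans (hf D₃ m3).symm)
  have := congrArg (eval 0) h
  norm_num at this
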